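/- **Setting.** Let $S$ and $A$ be Borel subsets of Euclidean spaces (states and actions), $\Theta$ a compact metric space (parameters), $1<p<\infty$ and $1/p+1/p'=1$. Let $\Gamma(s,\theta)\subseteq A$ ($s\in S$, $\theta\in\Theta$) be the admissible actions; $\Gamma$ is a nonempty- and compact-valued correspondence that is continuous on $S\times\Theta$, i.e. upper hemicontinuous (for every open $U\supseteq\Gamma(s,\theta)$ one has $\Gamma(s',\theta')\subseteq U$ for all $(s',\theta')$ near $(s,\theta)$) and lower hemicontinuous (the same with "$U\cap\Gamma\neq\emptyset$"). A policy is a sequence $\pi=(\pi_0,\pi_1,\dots)$ of maps $\pi_t:S\times\Theta\to A$, measurable in the state, with $\pi_t(s,\theta)\in\Gamma(s,\theta)$; $\Pi$ is the set of all policies. For every $t\in\mathbb N$ we are given: * a transition kernel $q_t(\cdot\,|\,s,a,\theta)$ on $S$ that is setwise continuous in $(s,a,\theta)$ (integrals of bounded measurable functions converge along convergent sequences), with $q_t(ds'|s,a,\theta)=m_t(s';s,a,\theta)\,Q_t(ds')$ for a probability measure $Q_t$ on $S$ and a measurable $m_t\ge 0$ such that $m_t(\cdot;s,a,\theta)\in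 L_{p'}(Q_t)$; * a cost $c_t:S\times A\times\Theta\to[0,\infty)$ that is bounded and jointly continuous; for the horizon $T$, also a bounded continuous terminal cost $c_T^{\rm end}:S\times\Theta\to[0,\infty)$; * one-step conditional risk measures $\rho_{\theta,t}(\cdot\,|\,h,s,a):L_p(Q_t)\to\mathbb R$, the risk of a function of the next state given the history $h$ of earlier state-action pairs, the state $s$ and the action $a$ at time $t$. The risk measures are *Markov and coherent*: there are risk transition mappings $\sigma_t(v,s,\mu,\theta)\in\mathbb R$, for $v\in L_p(Q_t)$, $s\in S$, $\theta\in\Theta$ and $\mu$ a probability measure with density in $L_{p'}(Q_t)$, such that for $a\in\Gamma(s,\theta)$ one has $\rho_{\theta,t}(v\,|\,h,s,a)=\sigma_t(v,s,q_t(s,a,\theta),\theta)$, this functional of $v$ is coherent (monotone, convex, translation equivariant, positively homogeneous), and $s\mapsto\sigma_t(v,s,q_t(s,g(s),\theta),\theta)$ is in $L_p(Q_t)$ for every measurable $g:S\to A$ with $g(s)\in\Gamma(s,\theta)$. The *risk envelope* $$\Phi_t(s,\mu,\theta)=\{\varphi\in L_p(Q_t)^*:\ \varphi\ge0,\ \langle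 1,\varphi\rangle=1,\ \langle v,\varphi\rangle\le\sigma_t(v,s,\mu,\theta)\ \ \forall v\in L_p(Q_t)\}$$ (with the weak-* topology) is assumed jointly continuous, i.e. upper and lower hemicontinuous along all sequences $s_n\to s$, $\mu_n\to\mu$ setwise, $\theta_n\to\theta$ on which it is nonempty, where the measures have densities in $L_{p'}(Q_t)$. For a history $h$ up to time $t$ and a state $s$ at time $t\le T$ let $$J_{t,T}(h,s,\theta;\pi)=c_t(s,\pi_t(s,\theta),\theta)+\rho_{\theta,t}\Big(c_{t+1}(S_{t+1},\pi_{t+1}(S_{t+1},\theta),\theta)+\rho_{\theta,t+1}\big(\cdots+\rho_{\theta,T-1}(c_T^{\rm end}(S_T,\theta))\cdots\big)\Big)$$ (for $t=T$ it is $c_T^{\rm end}(s,\theta)$), each $\rho_{\theta,r}$ being conditional on the history, state and action at time $r$, and $J_T(s,\theta;\pi)=J_{0,T}(\emptyset,s,\theta;\pi)$. **(i) Finite horizon.** For every $T\in\mathbb N$: all functions to which risk measures are applied lie in the required $L_p$ spaces. The minimum $\min_{\pi\in\Pi}J_T(s,\theta;\pi)$ is attained and is continuous on $S\times\Theta$;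 for every $t\le T$ the minimum $\min_{\pi\in\Pi}J_{t,T}(h,s,\theta;\pi)$ is attained, independent of $h$, and continuous in $(s,\theta)$. The optimal policy is semicontinuous in the following sense. (a) For $t<T$ and every $h$, the set of optimal actions $\{\pi_t(s,\theta):\pi\in\arg\min_{\Pi}J_{t,T}(h,s,\theta;\cdot)\}$ is nonempty and compact and is upper hemicontinuous in $(s,\theta)\in S\times\Theta$. (b) For every continuous $f:A\to\mathbb R$ there is $\pi^*\in\Pi$ that minimizes $J_{t,T}(h,s,\theta;\cdot)$ for all $t\le T$, $h$, $s$, $\theta$ and for which $f\circ\pi^*_t$ is lower semicontinuous on $S\times\Theta$ for all $t<T$. In particular, if $A\subseteq\mathbb R$, there is an optimal policy that is lower semicontinuous on $S\times\Theta$. **(ii) Infinite horizon.** Suppose in addition that $q_t\equiv q$, $Q_t\equiv Q$, $c_t\equiv c$ and $\sigma_t\equiv\sigma$ do not depend on $t$, and let $\gamma:\Theta\to(0,\bar\gamma]$ be continuous with $\bar\gamma<1$. Let $J_\infty(s,\theta;\pi)$ be the limit, as $N\to\infty$, of the nested risk of the first $N$ discounted costs, $$c(s,\pi_0(s,\theta),\theta)+\rho_{\theta,0}\Big(\gamma(\theta)c(S_1,\pi_1(S_1,\theta),\theta)+\rho_{\theta,1}\big(\gamma(\theta)^2c(S_2,\pi_2(S_2,\theta),\theta)+\cdots\big)\Big).$$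 Then all functions to which risk measures are applied lie in $L_p(Q)$, the limit exists for every $\pi\in\Pi$, and $\min_{\pi\in\Pi}J_\infty(s,\theta;\pi)$ is attained and is continuous on $S\times\Theta$. (a) The set of values at $(s,\theta)$ of the stationary policies that minimize $J_\infty(s,\theta;\cdot)$ over $\Pi$ is nonempty and compact and is upper hemicontinuous in $(s,\theta)$. (b) For every continuous $f:A\to\mathbb R$ there is a stationary policy $g$ that minimizes $J_\infty(s,\theta;\cdot)$ over $\Pi$ for all $(s,\theta)$ and for which $f\circ g$ is lower semicontinuous on $S\times\Theta$; in particular, if $A\subseteq\mathbb R$, there is a lower semicontinuous optimal stationary policy. -/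

import Mathlib

open MeasureTheory Filter Topology Set
open scoped ENNReal NNReal

namespace RiskMDP

noncomputable section

/-- Setwise convergence of probability measures: the integrals of every bounded measurable
function converge. -/
def SetwiseTendsto {S : Type*} [MeasurableSpace S] (μs : ℕ → ProbabilityMeasure S)
    (μ : ProbabilityMeasure S) : Prop :=
  ∀ f : S → ℝ, Measurable f → (∃ C : ℝ, ∀ x, |f x| ≤ C) →
    Tendsto (fun n => ∫ x, f x ∂(μs n : Measure S)) atTop (𝓝 (∫ x, f x ∂(μ : Measure S)))

/-- The probability measures on `S` with a density in the dual space `L_{p'}(Q)` of `L_p(Q)`. -/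
def DensityMeasures {S : Type*} [MeasurableSpace S] (Q : ProbabilityMeasure S) (p' : ℝ≥0∞) :
    Set (ProbabilityMeasure S) :=
  {μ | ∃ m : S → ℝ≥0, Measurable m ∧ MemLp (fun x => (m x : ℝ)) p' (Q : Measure S) ∧
    (μ : Measure S) = (Q : Measure S).withDensity (fun x => (m x : ℝ≥0∞))}

/-- The space of random costs `V = L_p(S, B(S), Q)`. -/
abbrev CostSpace {S : Type*} [MeasurableSpace S] (p : ℝ≥0∞) (Q : ProbabilityMeasure S) :=
  Lp ℝ p (Q : Measure S)

/-- A coherent (real-valued) risk measure on `L_p(Q)`. -/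
structure IsCoherent {S : Type*} [MeasurableSpace S] {p : ℝ≥0∞}
    {Q : ProbabilityMeasure S} (ρ : CostSpace p Q → ℝ) : Prop where
  monotone : ∀ X Y : CostSpace p Q, X ≤ Y → ρ X ≤ ρ Y
  convex : ∀ (X Y : CostSpace p Q) (α : ℝ), 0 ≤ α → α ≤ 1 →
    ρ (α • X + (1 - α) • Y) ≤ α * ρ X + (1 - α) * ρ Y
  translation : ∀ (X : CostSpace p Q) (α : ℝ),
    ρ (X + Lp.const p (Q : Measure S) α) = ρ X + α
  pos_homogeneous : ∀ (X : CostSpace p Q) (α : ℝ), 0 < α → ρ (α • X) = α * ρ X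

/-- The risk envelope of a functional `ρ` on `L_p(Q)`: the elements `φ` of the dual space, endowed
with the weak-* topology, that are probability densities (`φ ≥ 0`, `⟨1, φ⟩ = 1`) and satisfy
`⟨X, φ⟩ ≤ ρ(X)` for all `X`. -/
def riskEnvelope {S : Type*} [MeasurableSpace S] {p : ℝ≥0∞} [Fact (1 ≤ p)]
    {Q : ProbabilityMeasure S} (ρ : CostSpace p Q → ℝ) :
    Set (WeakDual ℝ (CostSpace p Q)) :=
  {φ | (∀ X : CostSpace p Q, 0 ≤ X → 0 ≤ φ X) ∧ φ (Lp.const p (Q : Measure S) 1) = 1 ∧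
    ∀ X : CostSpace p Q, φ X ≤ ρ X}

/-- Joint continuity (upper and lower hemicontinuity) of a correspondence `Φ` of
(state, measure, parameter) with values in a topological space: along every convergent sequence
`(s_n, μ_n, θ_n) → (s, μ, θ)` in its domain, where the measures lie in `M` and converge setwise. -/
def EnvelopeContinuous {S Θ E : Type*} [TopologicalSpace S] [MeasurableSpace S]
    [TopologicalSpace Θ] [TopologicalSpace E] (M : Set (ProbabilityMeasure S))
    (Φ : S → ProbabilityMeasure S → Θ → Set E) : Prop :=
  ∀ (ss : ℕ → S) (μs : ℕ → ProbabilityMeasure S) (θs : ℕ → Θ)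
    (s : S) (μ : ProbabilityMeasure S) (θ : Θ),
    (∀ n, μs n ∈ M) → μ ∈ M → (∀ n, (Φ (ss n) (μs n) (θs n)).Nonempty) → (Φ s μ θ).Nonempty →
    Tendsto ss atTop (𝓝 s) → SetwiseTendsto μs μ → Tendsto θs atTop (𝓝 θ) →
    (∀ U : Set E, IsOpen U → Φ s μ θ ⊆ U → ∀ᶠ n in atTop, Φ (ss n) (μs n) (θs n) ⊆ U) ∧
    (∀ U : Set E, IsOpen U → (Φ s μ θ ∩ U).Nonempty →
      ∀ᶠ n in atTop, (Φ (ss n) (μs n) (θs n) ∩ U).Nonempty)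

/-- The transition kernels are setwise continuous, with densities
`q_t(ds'|s,a,θ) = m_t(s';s,a,θ) Q_t(ds')`, and `m_t(·;s,a,θ)` in `L_{p'}(Q_t)`. -/
structure ContinuousKernel {S A Θ : Type*} [TopologicalSpace S] [MeasurableSpace S]
    [TopologicalSpace A] [MeasurableSpace A] [TopologicalSpace Θ] [MeasurableSpace Θ]
    (p' : ℝ≥0∞) (Q : ℕ → ProbabilityMeasure S)
    (q : ℕ → S → A → Θ → ProbabilityMeasure S) : Prop where
  setwise : ∀ (t : ℕ) (ss : ℕ → S) (as : ℕ → A) (θs : ℕ → Θ) (s : S) (a : A) (θ : Θ),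
    Tendsto ss atTop (𝓝 s) → Tendsto as atTop (𝓝 a) → Tendsto θs atTop (𝓝 θ) →
    SetwiseTendsto (fun n => q t (ss n) (as n) (θs n)) (q t s a θ)
  density : ∀ t : ℕ, ∃ m : S × S × A × Θ → ℝ≥0, Measurable m ∧ ∀ (s : S) (a : A) (θ : Θ),
    MemLp (fun s' => (m (s', s, a, θ) : ℝ)) p' (Q t : Measure S) ∧
    (q t s a θ : Measure S) =
      (Q t : Measure S).withDensity (fun s' => (m (s', s, a, θ) : ℝ≥0∞))

/-- The stage costs are nonnegative, bounded and jointly continuous. -/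
structure ContinuousCost {S A Θ : Type*} [TopologicalSpace S] [TopologicalSpace A]
    [TopologicalSpace Θ] (c : ℕ → S → A → Θ → ℝ) : Prop where
  nonneg : ∀ t s a θ, 0 ≤ c t s a θ
  bounded : ∀ t, ∃ C : ℝ, ∀ s a θ, c t s a θ ≤ C
  continuous : ∀ t, Continuous (fun x : S × A × Θ => c t x.1 x.2.1 x.2.2)

/-- The admissible-action correspondence is nonempty- and compact-valued and continuous. -/
structure ContinuousActions {S A Θ : Type*} [TopologicalSpace S] [TopologicalSpace A]
    [TopologicalSpace Θ] (Γ : S → Θ → Set A) : Prop where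
  nonempty : ∀ s θ, (Γ s θ).Nonempty
  compact : ∀ s θ, IsCompact (Γ s θ)
  upper : UpperHemicontinuous (fun x : S × Θ => Γ x.1 x.2)
  lower : LowerHemicontinuous (fun x : S × Θ => Γ x.1 x.2)

/-- The one-step conditional risk measures
`ρ t θ h s a : L_p(Q_t) → ℝ` (the risk of a function of the next state, given the past `h` of
state-action pairs, the state `s` and the action `a` at time `t`) are Markov and coherent with
risk transition mappings `σ t v s μ θ`. -/
structure IsMarkovCoherent {S A Θ : Type*} [MeasurableSpace S] [MeasurableSpace A] {p : ℝ≥0∞}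
    (Γ : S → Θ → Set A) (Q : ℕ → ProbabilityMeasure S)
    (q : ℕ → S → A → Θ → ProbabilityMeasure S)
    (ρ : (t : ℕ) → Θ → List (S × A) → S → A → CostSpace p (Q t) → ℝ)
    (σ : (t : ℕ) → CostSpace p (Q t) → S → ProbabilityMeasure S → Θ → ℝ) : Prop where
  markov : ∀ (t : ℕ) (θ : Θ) (h : List (S × A)) (s : S) (a : A), h.length = t → a ∈ Γ s θ →
    ∀ v : CostSpace p (Q t), ρ t θ h s a v = σ t v s (q t s a θ) θ
  coherent : ∀ (t : ℕ) (θ : Θ) (s : S) (a : A), a ∈ Γ s θ →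
    IsCoherent (fun v : CostSpace p (Q t) => σ t v s (q t s a θ) θ)
  memLp : ∀ (t : ℕ) (θ : Θ) (v : CostSpace p (Q t)) (g : S → A), Measurable g →
    (∀ s, g s ∈ Γ s θ) → MemLp (fun s => σ t v s (q t s (g s) θ) θ) p (Q t : Measure S)

/-- The feasible policies `π = (π_0, π_1, …)`, `π_t(s,θ) ∈ Γ(s,θ)`, measurable in the state. -/
def policies {S A Θ : Type*} [MeasurableSpace S] [MeasurableSpace A] (Γ : S → Θ → Set A) :
    Set (ℕ → S → Θ → A) :=
  {π | ∀ t, (∀ s θ, π t s θ ∈ Γ s θ) ∧ ∀ θ, Measurable (fun s => π t s θ)}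

open Classical in
/-- The class in `L_p(Q)` of a function (zero if the function is not in `L_p(Q)`). -/
def toCost {S : Type*} [MeasurableSpace S] (p : ℝ≥0∞) (Q : ProbabilityMeasure S) (f : S → ℝ) :
    CostSpace p Q :=
  if hf : MemLp f p (Q : Measure S) then hf.toLp f else 0

/-- The nested risk of the costs from time `t` on, given the past `h` and the state `s` at time
`t`, with `N` decision stages remaining, followed by the terminal cost `cT`:
`c_t(s,π_t) + ρ_t(c_{t+1}(S_{t+1},π_{t+1}) + ρ_{t+1}( ⋯ + ρ_{t+N-1}(cT(S_{t+N})) ⋯ ))`. -/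
def nestedCost {S A Θ : Type*} [MeasurableSpace S] {p : ℝ≥0∞} {Q : ℕ → ProbabilityMeasure S}
    (ρ : (t : ℕ) → Θ → List (S × A) → S → A → CostSpace p (Q t) → ℝ)
    (c : ℕ → S → A → Θ → ℝ) (cT : S → Θ → ℝ) (π : ℕ → S → Θ → A) (θ : Θ) :
    (N : ℕ) → (t : ℕ) → (h : List (S × A)) → S → ℝ
  | 0, _, _, s => cT s θ
  | N + 1, t, h, s =>
      c t s (π t s θ) θ + ρ t θ h s (π t s θ)
        (toCost p (Q t)
          (fun s' => nestedCost ρ c cT π θ N (t + 1) (h ++ [(s, π t s θ)]) s'))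

/-- The finite-horizon objective `J_T(s, θ; π)`. -/
def finiteCost {S A Θ : Type*} [MeasurableSpace S] {p : ℝ≥0∞} {Q : ℕ → ProbabilityMeasure S}
    (ρ : (t : ℕ) → Θ → List (S × A) → S → A → CostSpace p (Q t) → ℝ)
    (c : ℕ → S → A → Θ → ℝ) (cT : S → Θ → ℝ) (T : ℕ) (s : S) (θ : Θ)
    (π : ℕ → S → Θ → A) : ℝ :=
  nestedCost ρ c cT π θ T 0 [] s

/-- The discounted stage costs `γ(θ)^t c(s,a,θ)`. -/
def discounted {S A Θ : Type*} (γ : Θ → ℝ) (c : S → A → Θ → ℝ) : ℕ → S → A → Θ → ℝ :=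
  fun t s a θ => γ θ ^ t * c s a θ

/-- The infinite-horizon discounted objective `J_∞(s, θ; π)`: the limit, as `N → ∞`, of the nested
risk of the first `N` discounted costs. -/
def infiniteCost {S A Θ : Type*} [MeasurableSpace S] {p : ℝ≥0∞} {Q : ℕ → ProbabilityMeasure S}
    (ρ : (t : ℕ) → Θ → List (S × A) → S → A → CostSpace p (Q t) → ℝ)
    (c : S → A → Θ → ℝ) (γ : Θ → ℝ) (s : S) (θ : Θ) (π : ℕ → S → Θ → A) : ℝ :=
  limUnder atTop (fun N : ℕ => finiteCost ρ (discounted γ c) (fun _ _ => 0) N s θ π)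

/-- The optimal actions in state `s` at time `t`, given the past `h`, with `N` stages remaining:
the values `π_t(s,θ)` of the policies `π` that minimize the remaining nested risk. -/
def optimalActions {S A Θ : Type*} [MeasurableSpace S] [MeasurableSpace A] {p : ℝ≥0∞}
    {Q : ℕ → ProbabilityMeasure S} (Γ : S → Θ → Set A)
    (ρ : (t : ℕ) → Θ → List (S × A) → S → A → CostSpace p (Q t) → ℝ)
    (c : ℕ → S → A → Θ → ℝ) (cT : S → Θ → ℝ) (N t : ℕ) (h : List (S × A)) (s : S) (θ : Θ) :
    Set A :=
  {a | ∃ π ∈ policies Γ,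
    IsMinOn (fun π' => nestedCost ρ c cT π' θ N t h s) (policies Γ) π ∧ π t s θ = a}

/-- The values at `(s, θ)` of the stationary policies that minimize the infinite-horizon objective
over all policies. -/
def stationaryOptimalActions {S A Θ : Type*} [MeasurableSpace S] [MeasurableSpace A] {p : ℝ≥0∞}
    {Q : ℕ → ProbabilityMeasure S} (Γ : S → Θ → Set A)
    (ρ : (t : ℕ) → Θ → List (S × A) → S → A → CostSpace p (Q t) → ℝ)
    (c : S → A → Θ → ℝ) (γ : Θ → ℝ) (s : S) (θ : Θ) : Set A :=
  {a | ∃ g : S → Θ → A, (fun _ : ℕ => g) ∈ policies Γ ∧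
    IsMinOn (infiniteCost ρ c γ s θ) (policies Γ) (fun _ : ℕ => g) ∧ g s θ = a}

end

end RiskMDP

/-! The crux is that the one-step risk of `V(·,θ)` is jointly continuous in state, action and
parameter on the graph of `Γ`. A coherent risk is a finite monotone sublinear functional on the
Banach lattice `L_p`, hence bounded, and by Hahn–Banach it is the maximum of `φ v` over its
envelope. Upper hemicontinuity of the envelopes controls the limsup of the risks of a fixed `v`,
lower hemicontinuity the liminf. Banach–Steinhaus makes the risks along a convergent sequence
equi-Lipschitz, so `v` may vary too; and `V(·,θ_n)` converges in `L_p` by dominated convergence, as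
`p < ∞` (`tendsto_risk_of_envelope`, `tendsto_risk_of_tendsto`, `tendsto_toCost`).

Given this, Berge's maximum theorem shows that each dynamic programming step preserves bounded
continuous functions and has a compact-valued upper hemicontinuous minimizer correspondence.
Backward induction treats the finite horizon; a contraction on bounded continuous functions treats
the infinite one. Monotonicity of the risks makes the dynamic programming values lower bounds for
every policy, and greedy policies attain them. The Markov property makes the history irrelevant.

The optimal actions are exactly the minimizers. An optimal policy must use one, because even with
the best continuation any other action costs more than the value. Conversely, a greedy rule can be
altered at a single point `(s, θ)` without losing measurability or greediness.

For the lower semicontinuous policy, `f` is minimized over the minimizer correspondence: the minimum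
of a continuous function over an upper hemicontinuous compact-valued correspondence is lower
semicontinuous. Ties are broken by minimizing the coordinates of the action one after another, which
leaves a single action and thereby makes the selection measurable. -/

namespace RiskMDP

/-! ### Berge's maximum theorem -/

section Berge

variable {X A : Type*}

/-- The minimal value of `F x` on `Γ x`. -/
noncomputable def minVal (Γ : X → Set A) (F : X → A → ℝ) (x : X) : ℝ := sInf (F x '' Γ x)

/-- The minimizers of `F x` on `Γ x`. -/
def argMin (Γ : X → Set A) (F : X → A → ℝ) (x : X) : Set A :=
  {a | a ∈ Γ x ∧ ∀ b ∈ Γ x, F x a ≤ F x b}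

theorem argMin_subset (Γ : X → Set A) (F : X → A → ℝ) (x : X) : argMin Γ F x ⊆ Γ x :=
  fun _ h => h.1

theorem minVal_eq_of_mem_argMin {Γ : X → Set A} {F : X → A → ℝ} {x : X} {a : A}
    (ha : a ∈ argMin Γ F x) : minVal Γ F x = F x a :=
  IsLeast.csInf_eq ⟨mem_image_of_mem _ ha.1, by rintro _ ⟨b, hb, rfl⟩; exact ha.2 b hb⟩

theorem minVal_le {Γ : X → Set A} {F : X → A → ℝ} {x : X} (hne : (argMin Γ F x).Nonempty) {b : A}
    (hb : b ∈ Γ x) : minVal Γ F x ≤ F x b := by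
  obtain ⟨a, ha⟩ := hne
  rw [minVal_eq_of_mem_argMin ha]
  exact ha.2 b hb

theorem mem_argMin_of_le {Γ : X → Set A} {F : X → A → ℝ} {x : X} (hne : (argMin Γ F x).Nonempty)
    {a : A} (ha : a ∈ Γ x) (h : F x a ≤ minVal Γ F x) : a ∈ argMin Γ F x :=
  ⟨ha, fun _ hb => h.trans (minVal_le hne hb)⟩

variable [TopologicalSpace A]

theorem argMin_nonempty {Γ : X → Set A} {F : X → A → ℝ} {x : X} (hne : (Γ x).Nonempty)
    (hc : IsCompact (Γ x)) (hF : ContinuousOn (F x) (Γ x)) : (argMin Γ F x).Nonempty := by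
  obtain ⟨a, ha, h⟩ := hc.exists_isMinOn hne hF
  exact ⟨a, ha, fun b hb => h hb⟩

theorem argMin_isCompact {Γ : X → Set A} {F : X → A → ℝ} {x : X}
    (hc : IsCompact (Γ x)) (hF : ContinuousOn (F x) (Γ x)) : IsCompact (argMin Γ F x) := by
  rcases (Γ x).eq_empty_or_nonempty with h0 | hne
  · have : argMin Γ F x = ∅ := subset_empty_iff.1 (h0 ▸ argMin_subset Γ F x)
    rw [this]; exact isCompact_empty
  obtain ⟨a, ha⟩ := argMin_nonempty hne hc hF
  have heq : argMin Γ F x = Γ x ∩ F x ⁻¹' Iic (F x a) := by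
    ext b
    exact ⟨fun hb => ⟨hb.1, hb.2 a ha.1⟩, fun hb => ⟨hb.1, fun d hd => hb.2.trans (ha.2 d hd)⟩⟩
  rw [heq, inter_comm]
  have hK := isCompact_iff_compactSpace.1 hc
  have hcl : IsClosed {y : Γ x | F x y ≤ F x a} :=
    isClosed_le (continuousOn_iff_continuous_domRestrict.1 hF) continuous_const
  have := hcl.isCompact.image continuous_subtype_val
  convert this using 1
  ext b
  simp [and_comm]

variable [TopologicalSpace X]

/-- The graph of a correspondence. -/
def corrGraph (Γ : X → Set A) : Set (X × A) := {y | y.2 ∈ Γ y.1}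

theorem continuousOn_section {Γ : X → Set A} {F : X → A → ℝ}
    (hF : ContinuousOn (fun y : X × A => F y.1 y.2) (corrGraph Γ)) (x : X) :
    ContinuousOn (F x) (Γ x) :=
  hF.comp (f := fun a => (x, a)) (by fun_prop) fun _ ha => ha

/-- By compactness `O` contains a tube `u ×ˢ v` around `{x} × Γ x`, and upper hemicontinuity keeps
`Γ y` inside `v` for `y` near `x`. -/
theorem isOpen_forall_mem {Γ : X → Set A} (hc : ∀ x, IsCompact (Γ x))
    (hu : UpperHemicontinuous Γ) {O : Set (X × A)} (hO : IsOpen O) :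
    IsOpen {x | ∀ a ∈ Γ x, (x, a) ∈ O} := by
  rw [isOpen_iff_mem_nhds]
  intro x hx
  obtain ⟨u, v, hu', hv, hxu, hxv, huv⟩ := generalized_tube_lemma (isCompact_singleton (x := x))
    (hc x) hO (by rintro ⟨y, a⟩ ⟨rfl, ha⟩; exact hx a ha)
  filter_upwards [hu'.mem_nhds (hxu rfl), hu.forall_isOpen x v hv hxv] with y hy hyv a ha
  exact huv ⟨hy, hyv ha⟩

theorem isOpen_forall_lt {Γ : X → Set A} (hc : ∀ x, IsCompact (Γ x))
    (hu : UpperHemicontinuous Γ) {F : X → A → ℝ}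
    (hF : ContinuousOn (fun y : X × A => F y.1 y.2) (corrGraph Γ)) (r : ℝ) :
    IsOpen {x | ∀ a ∈ Γ x, r < F x a} := by
  -- `F` is controlled only on the graph of `Γ` (risks are coherent only for admissible actions), so
  -- the superlevel set is the trace of an open set of the product.
  obtain ⟨O, hO, hOe⟩ := continuousOn_iff'.1 hF (Ioi r) isOpen_Ioi
  convert isOpen_forall_mem hc hu hO using 1
  ext x
  refine forall₂_congr fun a ha => ?_
  have : (x, a) ∈ (fun y : X × A => F y.1 y.2) ⁻¹' Ioi r ∩ corrGraph Γ ↔ (x, a) ∈ O ∩ corrGraph Γ := by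
    rw [hOe]
  have hm : (x, a) ∈ corrGraph Γ := ha
  simpa [hm] using this

theorem lowerSemicontinuous_minVal {Γ : X → Set A} (hne : ∀ x, (Γ x).Nonempty)
    (hc : ∀ x, IsCompact (Γ x)) (hu : UpperHemicontinuous Γ) {F : X → A → ℝ}
    (hF : ContinuousOn (fun y : X × A => F y.1 y.2) (corrGraph Γ)) :
    LowerSemicontinuous (minVal Γ F) := by
  rw [lowerSemicontinuous_iff_isOpen_preimage]
  intro r
  convert isOpen_forall_lt hc hu hF r using 1
  ext x
  have hn := argMin_nonempty (hne x) (hc x) (continuousOn_section hF x)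
  constructor
  · intro h a ha
    exact lt_of_lt_of_le h (minVal_le hn ha)
  · intro h
    obtain ⟨a, ha⟩ := hn
    show r < minVal Γ F x
    rw [minVal_eq_of_mem_argMin ha]
    exact h a ha.1

theorem continuous_minVal {Γ : X → Set A} (hne : ∀ x, (Γ x).Nonempty)
    (hc : ∀ x, IsCompact (Γ x)) (hu : UpperHemicontinuous Γ) (hl : LowerHemicontinuous Γ)
    {F : X → A → ℝ} (hF : ContinuousOn (fun y : X × A => F y.1 y.2) (corrGraph Γ)) :
    Continuous (minVal Γ F) := by
  rw [continuous_iff_lower_upperSemicontinuous]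
  refine ⟨lowerSemicontinuous_minVal hne hc hu hF, ?_⟩
  intro x r hr
  obtain ⟨a, ha⟩ := argMin_nonempty (hne x) (hc x) (continuousOn_section hF x)
  rw [minVal_eq_of_mem_argMin ha] at hr
  -- Upper semicontinuity: lower hemicontinuity supplies, for `y` near `x`, an admissible action
  -- close to the minimizer `a`, whose value is still below `r`.
  have h1 := (hF (x, a) ha.1).eventually (gt_mem_nhds hr)
  rw [eventually_nhdsWithin_iff, nhds_prod_eq] at h1
  obtain ⟨P, hP, R, hR, h2⟩ := eventually_prod_iff.1 h1
  obtain ⟨W, hWR, hWo, haW⟩ := eventually_nhds_iff.1 hR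
  filter_upwards [hP, (lowerHemicontinuous_iff_isOpen_inter_nonempty.1 hl W hWo).mem_nhds
    (⟨a, ha.1, haW⟩ : (Γ x ∩ W).Nonempty)] with y hy hyW
  obtain ⟨b, hb, hbW⟩ := hyW
  exact lt_of_le_of_lt (minVal_le (argMin_nonempty (hne y) (hc y) (continuousOn_section hF y)) hb)
    (h2 hy (hWR b hbW) hb)

theorem upperHemicontinuous_argMin {Γ : X → Set A} (hne : ∀ x, (Γ x).Nonempty)
    (hc : ∀ x, IsCompact (Γ x)) (hu : UpperHemicontinuous Γ) (hl : LowerHemicontinuous Γ)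
    {F : X → A → ℝ} (hF : ContinuousOn (fun y : X × A => F y.1 y.2) (corrGraph Γ)) :
    UpperHemicontinuous (argMin Γ F) := by
  rw [upperHemicontinuous_iff_forall_isOpen]
  intro x W hW hxW
  have hV := continuous_minVal hne hc hu hl hF
  have hn : ∀ x, (argMin Γ F x).Nonempty :=
    fun x => argMin_nonempty (hne x) (hc x) (continuousOn_section hF x)
  have hG : ContinuousOn (fun y : X × A => F y.1 y.2 - minVal Γ F y.1) (corrGraph Γ) :=
    hF.sub (hV.comp continuous_fst).continuousOn
  obtain ⟨O, hO, hOe⟩ := continuousOn_iff'.1 hG (Ioi 0) isOpen_Ioi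
  have key : ∀ y a, a ∈ Γ y → ((y, a) ∈ O ↔ minVal Γ F y < F y a) := by
    intro y a ha
    have : (y, a) ∈ (fun y : X × A => F y.1 y.2 - minVal Γ F y.1) ⁻¹' Ioi 0 ∩ corrGraph Γ ↔
        (y, a) ∈ O ∩ corrGraph Γ := by
      rw [hOe]
    have hm : (y, a) ∈ corrGraph Γ := ha
    simpa [hm] using this.symm
  -- For `y` near `x`, every admissible action either lies in `W` or is strictly suboptimal at `y`.
  have hopen := isOpen_forall_mem hc hu (hO.union (hW.preimage continuous_snd))
  filter_upwards [hopen.mem_nhds (x := x) (by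
    intro a ha
    by_cases h : a ∈ argMin Γ F x
    · exact Or.inr (hxW h)
    · refine Or.inl ((key x a ha).2 (lt_of_not_ge fun h' => h (mem_argMin_of_le (hn x) ha h'))))]
    with y hy a ha
  rcases hy a ha.1 with h | h
  · exact absurd (minVal_eq_of_mem_argMin ha) ((key y a ha.1).1 h).ne
  · exact h

end Berge

/-! ### Measurable selection by lexicographic minimization -/

section Selection

variable {S A : Type*}

/-- Successive minimization of the functions of a list over a set. -/
def lexMin : List (A → ℝ) → Set A → Set A
  | [], M => M
  | f :: l, M => lexMin l {a | a ∈ M ∧ ∀ b ∈ M, f a ≤ f b}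

theorem lexMin_subset (l : List (A → ℝ)) (M : Set A) : lexMin l M ⊆ M := by
  induction l generalizing M with
  | nil => exact subset_rfl
  | cons f l ih => exact (ih _).trans fun a ha => ha.1

theorem lexMin_cons_subset (f : A → ℝ) (l : List (A → ℝ)) (M : Set A) :
    lexMin (f :: l) M ⊆ {a | a ∈ M ∧ ∀ b ∈ M, f a ≤ f b} :=
  lexMin_subset l _

theorem lexMin_eq (l : List (A → ℝ)) (M : Set A) {a b : A} (ha : a ∈ lexMin l M)
    (hb : b ∈ lexMin l M) : ∀ f ∈ l, f a = f b := by
  induction l generalizing M with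
  | nil => simp
  | cons f l ih =>
    intro g hg
    rcases List.mem_cons.1 hg with rfl | hg
    · have ha' := lexMin_cons_subset _ _ _ ha
      have hb' := lexMin_cons_subset _ _ _ hb
      exact le_antisymm (ha'.2 _ hb'.1) (hb'.2 _ ha'.1)
    · exact ih _ ha hb g hg

variable [TopologicalSpace A]

theorem lexMin_compact_nonempty (l : List (A → ℝ)) (hl : ∀ f ∈ l, Continuous f) (M : Set A)
    (hc : IsCompact M) (hne : M.Nonempty) :
    IsCompact (lexMin l M) ∧ (lexMin l M).Nonempty := by
  induction l generalizing M with
  | nil => exact ⟨hc, hne⟩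
  | cons f l ih =>
    have hf : ContinuousOn f M := (hl f (by simp)).continuousOn
    exact ih (fun g hg => hl g (by simp [hg])) _
      (argMin_isCompact (Γ := fun _ : Unit => M) (F := fun _ => f) (x := ()) hc hf)
      (argMin_nonempty (Γ := fun _ : Unit => M) (F := fun _ => f) (x := ()) hne hc hf)

theorem lexMin_measurable [MeasurableSpace S] (l : List (A → ℝ)) (hl : ∀ f ∈ l, Continuous f)
    (M : S → Set A) (hc : ∀ s, IsCompact (M s)) (hne : ∀ s, (M s).Nonempty)
    (hM : ∀ C : Set A, IsClosed C → MeasurableSet {s | (M s ∩ C).Nonempty}) :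
    ∀ C : Set A, IsClosed C → MeasurableSet {s | (lexMin l (M s) ∩ C).Nonempty} := by
  induction l generalizing M with
  | nil => exact hM
  | cons f l ih =>
    have hfc : Continuous f := hl f (by simp)
    refine ih (fun g hg => hl g (by simp [hg])) _
      (fun s => argMin_isCompact (Γ := M) (F := fun _ => f) (hc s) hfc.continuousOn)
      (fun s => argMin_nonempty (Γ := M) (F := fun _ => f) (hne s) (hc s) hfc.continuousOn) ?_
    intro C hC
    -- `C` contains a minimizer iff every rational level reached by `f` on `M s` is also reached on
    -- `M s ∩ C`; compactness of `M s ∩ C` passes from rational levels to the minimum itself.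
    have heq : {s | ({a | a ∈ M s ∧ ∀ b ∈ M s, f a ≤ f b} ∩ C).Nonempty} =
        ⋂ r : ℚ, ({s | (M s ∩ f ⁻¹' Iic (r : ℝ)).Nonempty}ᶜ ∪
          {s | (M s ∩ (C ∩ f ⁻¹' Iic (r : ℝ))).Nonempty}) := by
      ext s
      simp only [mem_iInter, mem_union, mem_compl_iff, mem_ofPred_eq]
      constructor
      · rintro ⟨a, ⟨haM, hmin⟩, haC⟩ r
        rw [← imp_iff_not_or]
        rintro ⟨b, hb, hbr⟩
        exact ⟨a, haM, haC, (hmin b hb).trans hbr⟩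
      · intro h
        obtain ⟨m, hm, hmin⟩ := (hc s).exists_isMinOn (hne s) hfc.continuousOn
        have hex : (M s ∩ C ∩ f ⁻¹' Iic (f m)).Nonempty := by
          have hcc : IsCompact (M s ∩ C) := (hc s).inter_right hC
          have hP : ∀ r : ℚ, f m < r → (M s ∩ (C ∩ f ⁻¹' Iic (r : ℝ))).Nonempty := by
            intro r hr
            exact (h r).resolve_left (not_not.2 ⟨m, hm, hr.le⟩)
          have hne' : (M s ∩ C).Nonempty := by
            obtain ⟨r, hr, -⟩ := exists_rat_btwn (lt_add_one (f m))
            obtain ⟨a, ha, haC, -⟩ := hP r hr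
            exact ⟨a, ha, haC⟩
          obtain ⟨a, ha, hamin⟩ := hcc.exists_isMinOn hne' hfc.continuousOn
          refine ⟨a, ha, ?_⟩
          by_contra hlt
          obtain ⟨r, hr, hr'⟩ := exists_rat_btwn (lt_of_not_ge (fun h' => hlt h') : f m < f a)
          obtain ⟨b, hb, hbC, hbr⟩ := hP r hr
          have h1 : f a ≤ f b := hamin ⟨hb, hbC⟩
          have h2 : f b ≤ r := hbr
          linarith
        obtain ⟨a, ⟨haM, haC⟩, ha⟩ := hex
        exact ⟨a, ⟨haM, fun b hb => le_trans ha (hmin hb)⟩, haC⟩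
    rw [heq]
    exact MeasurableSet.iInter fun r =>
      (hM _ (isClosed_Iic.preimage hfc)).compl.union (hM _ (hC.inter (isClosed_Iic.preimage hfc)))

/-- An upper hemicontinuous compact-valued correspondence has a selector that is measurable in the
first variable and minimizes a given continuous function. -/
theorem exists_measurable_argMin {Θ : Type*} [TopologicalSpace S] [TopologicalSpace Θ]
    [MeasurableSpace S] [OpensMeasurableSpace S] [MeasurableSpace A] [BorelSpace A]
    {l : List (A → ℝ)} (hl : ∀ g ∈ l, Continuous g)
    (hsep : ∀ a b : A, (∀ g ∈ l, g a = g b) → a = b)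
    {M : S × Θ → Set A} (hc : ∀ x, IsCompact (M x)) (hne : ∀ x, (M x).Nonempty)
    (hu : UpperHemicontinuous M) {f : A → ℝ} (hf : Continuous f) :
    ∃ g : S → Θ → A, (∀ s θ, g s θ ∈ argMin M (fun _ => f) (s, θ)) ∧
      ∀ θ, Measurable fun s => g s θ := by
  have hl' : ∀ g ∈ f :: l, Continuous g := by
    intro g hg
    rcases List.mem_cons.1 hg with rfl | hg
    exacts [hf, hl g hg]
  -- The functions of `l` separate points, so the lexicographic minimizer is unique and the preimage
  -- of a closed set under `g` is the set where `lexMin` meets it.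
  choose g hg using fun x => (lexMin_compact_nonempty (f :: l) hl' (M x) (hc x) (hne x)).2
  refine ⟨fun s θ => g (s, θ), fun s θ => lexMin_cons_subset _ _ _ (hg (s, θ)), fun θ => ?_⟩
  refine measurable_of_isClosed fun C hC => ?_
  have hcl : ∀ C : Set A, IsClosed C → MeasurableSet {s | (M (s, θ) ∩ C).Nonempty} := by
    intro C hC
    have h1 := (upperHemicontinuous_iff_isClosed_compl_preimage_Iic_compl.1 hu C hC).preimage
      (f := fun s : S => (s, θ)) (by fun_prop)
    convert h1.measurableSet using 1
    ext s
    simp [not_subset, Set.Nonempty]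
  convert lexMin_measurable (f :: l) hl' (fun s => M (s, θ)) (fun s => hc _) (fun s => hne _)
    hcl C hC using 1
  ext s
  constructor
  · intro h
    exact ⟨g (s, θ), hg _, h⟩
  · rintro ⟨a, ha, haC⟩
    have : g (s, θ) = a := hsep _ _ fun k hk => lexMin_eq _ _ (hg (s, θ)) ha k (by simp [hk])
    simpa [this] using haC

end Selection

end RiskMDP

namespace RiskMDP

/-! ### Coherent risk measures: boundedness, duality, convergence -/

section Coherent

variable {S : Type*} [MeasurableSpace S] {p : ℝ≥0∞} {Q : ProbabilityMeasure S}

theorem smul_nonneg_cost {c : ℝ} (hc : 0 ≤ c) {X : CostSpace p Q} (hX : 0 ≤ X) : 0 ≤ c • X := by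
  rw [← Lp.coeFn_nonneg] at hX ⊢
  filter_upwards [hX, Lp.coeFn_smul c X] with x h1 h2
  rw [h2]
  exact mul_nonneg hc h1

namespace IsCoherent

variable {ρ : CostSpace p Q → ℝ} (hρ : IsCoherent ρ)
include hρ

theorem map_zero : ρ 0 = 0 := by
  have := hρ.pos_homogeneous 0 2 two_pos
  rw [smul_zero] at this
  linarith

theorem map_const (α : ℝ) : ρ (Lp.const p (Q : Measure S) α) = α := by
  have := hρ.translation 0 α
  rwa [zero_add, hρ.map_zero, zero_add] at this

theorem map_add_le (X Y : CostSpace p Q) : ρ (X + Y) ≤ ρ X + ρ Y := by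
  have h1 := hρ.convex X Y (1 / 2) (by norm_num) (by norm_num)
  have h2 : X + Y = (2 : ℝ) • ((1 / 2 : ℝ) • X + (1 - 1 / 2 : ℝ) • Y) := by
    rw [smul_add, smul_smul, smul_smul]; norm_num
  rw [h2, hρ.pos_homogeneous _ 2 two_pos]
  linarith

theorem neg_le_map_neg (X : CostSpace p Q) : -ρ X ≤ ρ (-X) := by
  have := hρ.map_add_le X (-X)
  rw [add_neg_cancel, hρ.map_zero] at this
  linarith

theorem map_smul_nonneg {c : ℝ} (hc : 0 ≤ c) (X : CostSpace p Q) : ρ (c • X) = c * ρ X := by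
  rcases hc.eq_or_lt with rfl | hc
  · rw [zero_smul, hρ.map_zero, zero_mul]
  · exact hρ.pos_homogeneous X c hc

variable [Fact (1 ≤ p)]

/-- Otherwise some `X n` have `ρ (X n) > 4 ^ n * ‖X n‖`. The normalized `|X n|`, weighted by `2 ^
(-n)`, have a sum in `L_p` that dominates each of its terms, so its risk is at least `2 ^ n` for all
`n`. -/
theorem exists_bound : ∃ K : ℝ, ∀ X : CostSpace p Q, ρ X ≤ K * ‖X‖ := by
  by_contra! h
  choose X hX using fun n : ℕ => h (4 ^ n)
  have hX0 : ∀ n, 0 < ‖X n‖ := by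
    intro n
    refine norm_pos_iff.2 fun h0 => ?_
    have := hX n
    rw [h0, hρ.map_zero, norm_zero, mul_zero] at this
    exact lt_irrefl _ this
  let Y : ℕ → CostSpace p Q := fun n => ((1 / 2) ^ n * ‖X n‖⁻¹ : ℝ) • |X n|
  have hY0 : ∀ n, 0 ≤ Y n := fun n => smul_nonneg_cost (by positivity) (abs_nonneg _)
  have hYn : ∀ n, ‖Y n‖ ≤ (1 / 2) ^ n := by
    intro n
    have h1 : ‖Y n‖ = ((1 / 2) ^ n * ‖X n‖⁻¹) * ‖X n‖ := by
      show ‖((1 / 2) ^ n * ‖X n‖⁻¹ : ℝ) • |X n|‖ = _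
      rw [norm_smul, norm_abs_eq_norm, Real.norm_of_nonneg (by positivity)]
    rw [h1, inv_mul_cancel_right₀ (hX0 n).ne']
  have hsum : Summable Y :=
    Summable.of_norm_bounded (summable_geometric_of_lt_one (by norm_num) (by norm_num)) hYn
  have hlow : ∀ n : ℕ, (2 : ℝ) ^ n ≤ ρ (∑' i, Y i) := by
    intro n
    refine le_trans ?_ (hρ.monotone _ _ (hsum.le_tsum n fun j _ => hY0 j))
    show (2 : ℝ) ^ n ≤ ρ (((1 / 2) ^ n * ‖X n‖⁻¹ : ℝ) • |X n|)
    rw [hρ.map_smul_nonneg (by positivity)]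
    have h1 : 4 ^ n * ‖X n‖ ≤ ρ |X n| := (hX n).le.trans (hρ.monotone _ _ (le_abs_self _))
    have h2 : (2 : ℝ) ^ n = ((1 / 2) ^ n * ‖X n‖⁻¹) * (4 ^ n * ‖X n‖) := by
      rw [show ((1 / 2) ^ n * ‖X n‖⁻¹) * (4 ^ n * ‖X n‖) = ((1 / 2) ^ n * 4 ^ n) *
        (‖X n‖⁻¹ * ‖X n‖) by ring, inv_mul_cancel₀ (hX0 n).ne', ← mul_pow]
      norm_num
    rw [h2]
    exact mul_le_mul_of_nonneg_left h1 (by positivity)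
  obtain ⟨n, hn⟩ := pow_unbounded_of_one_lt (ρ (∑' i, Y i)) (one_lt_two)
  exact absurd (hlow n) (not_le.2 hn)

/-- The dual representation: the risk is attained on the risk envelope. -/
theorem exists_mem_riskEnvelope (v : CostSpace p Q) : ∃ φ ∈ riskEnvelope ρ, φ v = ρ v := by
  have H : ∀ c : ℝ, c • v = 0 → (RingHom.id ℝ) c • ρ v = 0 := by
    intro c hc
    rcases smul_eq_zero.1 hc with rfl | rfl
    · simp
    · simp [hρ.map_zero]
  -- Hahn–Banach: the functional `c • v ↦ c * ρ v` is dominated by `ρ` on the line of `v`; negative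
  -- `c` uses `-ρ X ≤ ρ (-X)`. The linear extension satisfies all envelope conditions because of
  -- this domination.
  obtain ⟨g, hg, hle⟩ := exists_extension_of_le_sublinear (LinearPMap.mkSpanSingleton' v (ρ v) H) ρ
    (fun c hc x => hρ.pos_homogeneous x c hc) hρ.map_add_le (by
      rintro ⟨x, hx⟩
      obtain ⟨c, rfl⟩ := Submodule.mem_span_singleton.1 hx
      rw [LinearPMap.mkSpanSingleton'_apply]
      show c * ρ v ≤ ρ (c • v)
      rcases le_total 0 c with hc | hc
      · rw [hρ.map_smul_nonneg hc]
      · have h1 := hρ.neg_le_map_neg ((-c) • v)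
        rw [hρ.map_smul_nonneg (by linarith), ← neg_smul, neg_neg] at h1
        linarith)
  obtain ⟨K, hK⟩ := hρ.exists_bound
  let φ : CostSpace p Q →L[ℝ] ℝ := g.mkContinuous K (by
    intro x
    rw [Real.norm_eq_abs, abs_le]
    have h1 := (hle (-x)).trans (hK (-x))
    rw [map_neg, norm_neg] at h1
    exact ⟨by linarith, (hle x).trans (hK x)⟩)
  refine ⟨StrongDual.toWeakDual φ, ⟨fun X hX => ?_, ?_, fun X => hle X⟩, ?_⟩
  · have h1 : g (-X) ≤ ρ (-X) := hle (-X)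
    have h2 := hρ.monotone (-X) 0 (neg_nonpos.2 hX)
    rw [hρ.map_zero] at h2
    rw [map_neg] at h1
    show 0 ≤ g X
    linarith
  -- Domination at the constants `1` and `-1`, whose risks are `1` and `-1`, forces equality.
  · show g _ = 1
    have h1 := hle (Lp.const p (Q : Measure S) 1)
    have h2 := hle (-Lp.const p (Q : Measure S) 1)
    rw [hρ.map_const] at h1
    rw [← map_neg (Lp.const p (Q : Measure S)), hρ.map_const, map_neg (Lp.const p (Q : Measure S)),
      map_neg] at h2
    linarith
  · show g v = ρ v
    exact (hg ⟨v, Submodule.mem_span_singleton_self v⟩).trans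
      (LinearPMap.mkSpanSingleton'_apply_self v (ρ v) H _)

theorem riskEnvelope_nonempty : (riskEnvelope ρ).Nonempty := by
  obtain ⟨φ, hφ, -⟩ := hρ.exists_mem_riskEnvelope 0
  exact ⟨φ, hφ⟩

end IsCoherent

variable [Fact (1 ≤ p)]

/-- Hemicontinuity of the risk envelopes implies the convergence of the risks. -/
theorem tendsto_risk_of_envelope {ρs : ℕ → CostSpace p Q → ℝ} {ρ : CostSpace p Q → ℝ}
    (hρs : ∀ n, IsCoherent (ρs n)) (hρ : IsCoherent ρ)
    (hup : ∀ U : Set (WeakDual ℝ (CostSpace p Q)), IsOpen U → riskEnvelope ρ ⊆ U →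
      ∀ᶠ n in atTop, riskEnvelope (ρs n) ⊆ U)
    (hlo : ∀ U : Set (WeakDual ℝ (CostSpace p Q)), IsOpen U → (riskEnvelope ρ ∩ U).Nonempty →
      ∀ᶠ n in atTop, (riskEnvelope (ρs n) ∩ U).Nonempty) (v : CostSpace p Q) :
    Tendsto (fun n => ρs n v) atTop (𝓝 (ρ v)) := by
  have hev := WeakDual.eval_continuous (𝕜 := ℝ) v
  refine tendsto_order.2 ⟨fun r hr => ?_, fun r hr => ?_⟩
  -- A maximizing `φ` of the limit envelope has elements of nearby envelopes in the weak-* open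
  -- half-space `{φ | r < φ v}`.
  · obtain ⟨φ, hφ, hφv⟩ := hρ.exists_mem_riskEnvelope v
    filter_upwards [hlo _ (isOpen_Ioi.preimage hev) ⟨φ, hφ, hφv ▸ hr⟩] with n hn
    obtain ⟨ψ, hψ, hψv⟩ := hn
    exact lt_of_lt_of_le hψv (hψ.2.2 v)
  · filter_upwards [hup _ (isOpen_Iio.preimage hev) fun φ hφ => (hφ.2.2 v).trans_lt hr] with n hn
    obtain ⟨φ, hφ, hφv⟩ := (hρs n).exists_mem_riskEnvelope v
    have h1 : φ v < r := hn hφ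
    rwa [hφv] at h1

/-- Pointwise convergent sequences of coherent risk measures converge continuously. -/
theorem tendsto_risk_of_tendsto {ρs : ℕ → CostSpace p Q → ℝ} {ρ : CostSpace p Q → ℝ}
    (hρs : ∀ n, IsCoherent (ρs n)) (h : ∀ v, Tendsto (fun n => ρs n v) atTop (𝓝 (ρ v)))
    {vs : ℕ → CostSpace p Q} {v : CostSpace p Q} (hv : Tendsto vs atTop (𝓝 v)) :
    Tendsto (fun n => ρs n (vs n)) atTop (𝓝 (ρ v)) := by
  -- All elements of all envelopes form one family. It is pointwise bounded, since `±φ x ≤ ρs n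
  -- (±x)` and these sequences converge, so Banach–Steinhaus bounds the norms uniformly.
  let g : (Σ n, riskEnvelope (ρs n)) → CostSpace p Q →L[ℝ] ℝ :=
    fun i => WeakDual.toStrongDual (i.2 : WeakDual ℝ (CostSpace p Q))
  obtain ⟨K, hK⟩ : ∃ K, ∀ i, ‖g i‖ ≤ K := by
    refine banach_steinhaus fun x => ?_
    obtain ⟨B₁, hB₁⟩ := (h x).bddAbove_range
    obtain ⟨B₂, hB₂⟩ := (h (-x)).bddAbove_range
    refine ⟨max B₁ B₂, fun i => ?_⟩
    have h1 : g i x ≤ ρs i.1 x := i.2.2.2.2 x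
    have h2 : g i (-x) ≤ ρs i.1 (-x) := i.2.2.2.2 (-x)
    rw [map_neg] at h2
    have h3 : ρs i.1 x ≤ B₁ := hB₁ ⟨i.1, rfl⟩
    have h4 : ρs i.1 (-x) ≤ B₂ := hB₂ ⟨i.1, rfl⟩
    rw [Real.norm_eq_abs]
    exact abs_le.2 ⟨by linarith [le_max_right B₁ B₂], by linarith [le_max_left B₁ B₂]⟩
  have hbd : ∀ n x, ρs n x ≤ K * ‖x‖ := by
    intro n x
    obtain ⟨φ, hφ, hφx⟩ := (hρs n).exists_mem_riskEnvelope x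
    have h1 := (g ⟨n, φ, hφ⟩).le_of_opNorm_le (hK _) x
    have h2 : g ⟨n, φ, hφ⟩ x = ρs n x := hφx
    rw [← h2]
    exact (le_abs_self _).trans h1
  -- Subadditivity turns the common bound into a common Lipschitz constant.
  have hdiff : ∀ n, |ρs n (vs n) - ρs n v| ≤ K * ‖vs n - v‖ := by
    intro n
    have h1 := ((hρs n).map_add_le (vs n - v) v)
    have h2 := ((hρs n).map_add_le (v - vs n) (vs n))
    rw [sub_add_cancel] at h1 h2
    have h3 := hbd n (vs n - v)
    have h4 := hbd n (v - vs n)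
    rw [norm_sub_rev] at h4
    exact abs_le.2 ⟨by linarith, by linarith⟩
  have h0 : Tendsto (fun n => K * ‖vs n - v‖) atTop (𝓝 0) := by
    simpa using (tendsto_iff_norm_sub_tendsto_zero.1 hv).const_mul K
  have h1 : Tendsto (fun n => ρs n (vs n) - ρs n v) atTop (𝓝 0) :=
    squeeze_zero_norm hdiff h0
  simpa using h1.add (h v)

end Coherent

/-! ### Bounded measurable costs as elements of `L_p` -/

section BoundedCosts

variable {S : Type*} [MeasurableSpace S] {p : ℝ≥0∞} {Q : ProbabilityMeasure S}

/-- Bounded measurable real functions. -/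
def BddMeas (f : S → ℝ) : Prop := Measurable f ∧ ∃ C : ℝ, ∀ x, |f x| ≤ C

theorem BddMeas.memLp {f : S → ℝ} (hf : BddMeas f) : MemLp f p (Q : Measure S) := by
  obtain ⟨hm, C, hC⟩ := hf
  exact MemLp.of_bound hm.aestronglyMeasurable C (ae_of_all _ hC)

theorem BddMeas.affine {f : S → ℝ} (hf : BddMeas f) (α β : ℝ) :
    BddMeas fun x => α * f x + β := by
  obtain ⟨hm, C, hC⟩ := hf
  refine ⟨by fun_prop, |α| * C + |β|, fun x => (abs_add_le _ _).trans ?_⟩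
  rw [abs_mul]
  gcongr
  exact hC x

theorem BddMeas.const (β : ℝ) : BddMeas fun _ : S => β :=
  ⟨measurable_const, |β|, fun _ => le_rfl⟩

theorem toCost_eq {f : S → ℝ} (hf : BddMeas f) : toCost p Q f = hf.memLp.toLp f :=
  dif_pos _

theorem toCost_mono {f g : S → ℝ} (hf : BddMeas f) (hg : BddMeas g) (h : ∀ x, f x ≤ g x) :
    toCost p Q f ≤ toCost p Q g := by
  rw [toCost_eq hf, toCost_eq hg, ← Lp.coeFn_le]
  filter_upwards [(hf.memLp (p := p) (Q := Q)).coeFn_toLp,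
    (hg.memLp (p := p) (Q := Q)).coeFn_toLp] with x h1 h2
  rw [h1, h2]
  exact h x

theorem toCost_affine {f : S → ℝ} (hf : BddMeas f) (α β : ℝ) :
    toCost p Q (fun x => α * f x + β) = α • toCost p Q f + Lp.const p (Q : Measure S) β := by
  rw [toCost_eq hf, toCost_eq (hf.affine α β)]
  rfl

/-- Dominated convergence for the `p`-th power of the difference, with the constant `2 * C` as
bound; this needs `p` finite. -/
theorem tendsto_toCost [Fact (1 ≤ p)] (hp : p ≠ ⊤) {fs : ℕ → S → ℝ} {f : S → ℝ}
    (hfs : ∀ n, Measurable (fs n)) (hf : Measurable f) {C : ℝ} (hC : ∀ n x, |fs n x| ≤ C)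
    (h : ∀ x, Tendsto (fun n => fs n x) atTop (𝓝 (f x))) :
    Tendsto (fun n => toCost p Q (fs n)) atTop (𝓝 (toCost p Q f)) := by
  have hfC : ∀ x, |f x| ≤ C := fun x => le_of_tendsto (h x).abs (Eventually.of_forall fun n => hC n x)
  have hbs : ∀ n, BddMeas (fs n) := fun n => ⟨hfs n, C, hC n⟩
  have hb : BddMeas f := ⟨hf, C, hfC⟩
  have hp0 : p ≠ 0 := (zero_lt_one.trans_le (Fact.out : 1 ≤ p)).ne'
  have hpr : 0 < p.toReal := ENNReal.toReal_pos hp0 hp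
  simp_rw [toCost_eq (hbs _), toCost_eq hb]
  rw [Lp.tendsto_Lp_iff_tendsto_eLpNorm'']
  simp_rw [eLpNorm_eq_lintegral_rpow_enorm_toReal hp0 hp]
  have key : Tendsto (fun n => ∫⁻ x, ‖(fs n - f) x‖ₑ ^ p.toReal ∂(Q : Measure S)) atTop
      (𝓝 (∫⁻ _, 0 ∂(Q : Measure S))) := by
    refine tendsto_lintegral_of_dominated_convergence
      (fun _ => (ENNReal.ofReal (2 * C)) ^ p.toReal) ?_ ?_ ?_ ?_
    · intro n
      exact (((hfs n).sub hf).enorm).pow_const _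
    · intro n
      refine ae_of_all _ fun x => ENNReal.rpow_le_rpow ?_ hpr.le
      rw [Real.enorm_eq_ofReal_abs]
      refine ENNReal.ofReal_le_ofReal ?_
      have h1 := abs_sub (fs n x) (f x)
      have h2 := hC n x
      have h3 := hfC x
      show |fs n x - f x| ≤ 2 * C
      linarith
    · rw [lintegral_const, measure_univ, mul_one]
      exact ENNReal.rpow_ne_top_of_nonneg hpr.le ENNReal.ofReal_ne_top
    · refine ae_of_all _ fun x => ?_
      have h1 : Tendsto (fun n => (fs n - f) x) atTop (𝓝 0) := by
        simpa using (h x).sub_const (f x)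
      have h2 : Tendsto (fun n => ‖(fs n - f) x‖ₑ) atTop (𝓝 0) := by
        simpa using h1.enorm
      have h3 := (ENNReal.continuous_rpow_const (y := p.toReal)).tendsto 0
      rw [ENNReal.zero_rpow_of_pos hpr] at h3
      exact h3.comp h2
  rw [lintegral_zero] at key
  have h3 := (ENNReal.continuous_rpow_const (y := 1 / p.toReal)).tendsto 0
  rw [ENNReal.zero_rpow_of_pos (by positivity)] at h3
  exact h3.comp key

end BoundedCosts

/-! ### Joint continuity of the one-step risk -/

section OneStep

variable {S A Θ : Type*} [TopologicalSpace S] [MeasurableSpace S]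
  [TopologicalSpace A] [MeasurableSpace A] [TopologicalSpace Θ] [MeasurableSpace Θ]

/-- The properties of the one-step risk `R s a θ f` of a bounded measurable function `f` of the
next state that dynamic programming relies on. -/
structure RegularRisk (Γ : S → Θ → Set A) (R : S → A → Θ → (S → ℝ) → ℝ) : Prop where
  mono : ∀ s a θ, a ∈ Γ s θ → ∀ f g, BddMeas f → BddMeas g → (∀ x, f x ≤ g x) →
    R s a θ f ≤ R s a θ g
  affine : ∀ s a θ, a ∈ Γ s θ → ∀ f, BddMeas f → ∀ α β : ℝ, 0 ≤ α →
    R s a θ (fun x => α * f x + β) = α * R s a θ f + β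
  -- `V` need not be continuous in the state, so the condition also covers the costs of policies
  -- that are merely measurable.
  continuousOn : ∀ V : S × Θ → ℝ, (∀ θ, Measurable fun s => V (s, θ)) →
    (∀ s, Continuous fun θ => V (s, θ)) → (∃ C, ∀ x, |V x| ≤ C) →
    ContinuousOn (fun y : (S × Θ) × A => R y.1.1 y.2 y.1.2 fun s' => V (s', y.1.2))
      (corrGraph fun x : S × Θ => Γ x.1 x.2)

theorem IsMarkovCoherent.regularRisk [FirstCountableTopology S] [FirstCountableTopology A]
    [FirstCountableTopology Θ] {p p' : ℝ≥0∞} [Fact (1 ≤ p)] (hp : p ≠ ⊤) {Γ : S → Θ → Set A}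
    {Q : ℕ → ProbabilityMeasure S} {q : ℕ → S → A → Θ → ProbabilityMeasure S}
    {ρ : (t : ℕ) → Θ → List (S × A) → S → A → CostSpace p (Q t) → ℝ}
    {σ : (t : ℕ) → CostSpace p (Q t) → S → ProbabilityMeasure S → Θ → ℝ}
    (hσ : IsMarkovCoherent Γ Q q ρ σ) (hq : ContinuousKernel p' Q q)
    {t : ℕ} (henv : EnvelopeContinuous (DensityMeasures (Q t) p')
      (fun s μ θ => riskEnvelope (fun v => σ t v s μ θ))) :
    RegularRisk Γ (fun s a θ f => σ t (toCost p (Q t) f) s (q t s a θ) θ) where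
  mono s a θ ha f g hf hg h := (hσ.coherent t θ s a ha).monotone _ _ (toCost_mono hf hg h)
  affine s a θ ha f hf α β hα := by
    have hc := hσ.coherent t θ s a ha
    rw [toCost_affine hf]
    exact (hc.translation _ β).trans (congrArg (· + β) (hc.map_smul_nonneg hα _))
  continuousOn V hVm hVc hVb := by
    obtain ⟨C, hC⟩ := hVb
    have hdens : ∀ s a θ, q t s a θ ∈ DensityMeasures (Q t) p' := by
      intro s a θ
      obtain ⟨m, hm, h⟩ := hq.density t
      exact ⟨fun s' => m (s', s, a, θ), hm.comp (by fun_prop), h s a θ⟩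
    -- Envelope continuity is a statement about sequences; first countability makes sequences
    -- suffice. Along them the kernels converge setwise and coherence makes the envelopes nonempty.
    rw [continuousOn_iff_continuous_domRestrict, continuous_iff_seqContinuous]
    intro ys y hy
    have hy' : Tendsto (fun n => (ys n : (S × Θ) × A)) atTop (𝓝 y) :=
      (continuous_subtype_val.tendsto y).comp hy
    have hs : Tendsto (fun n => (ys n).1.1.1) atTop (𝓝 y.1.1.1) :=
      ((continuous_fst.comp continuous_fst).tendsto _).comp hy'
    have hθ : Tendsto (fun n => (ys n).1.1.2) atTop (𝓝 y.1.1.2) :=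
      ((continuous_snd.comp continuous_fst).tendsto _).comp hy'
    have ha : Tendsto (fun n => (ys n).1.2) atTop (𝓝 y.1.2) :=
      (continuous_snd.tendsto _).comp hy'
    have hcoh : ∀ n, IsCoherent fun v : CostSpace p (Q t) =>
        σ t v (ys n).1.1.1 (q t (ys n).1.1.1 (ys n).1.2 (ys n).1.1.2) (ys n).1.1.2 :=
      fun n => hσ.coherent t _ _ _ (ys n).2
    have hcoh' : IsCoherent fun v : CostSpace p (Q t) =>
        σ t v y.1.1.1 (q t y.1.1.1 y.1.2 y.1.1.2) y.1.1.2 := hσ.coherent t _ _ _ y.2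
    obtain ⟨hup, hlo⟩ := henv (fun n => (ys n).1.1.1)
      (fun n => q t (ys n).1.1.1 (ys n).1.2 (ys n).1.1.2) (fun n => (ys n).1.1.2) y.1.1.1
      (q t y.1.1.1 y.1.2 y.1.1.2) y.1.1.2 (fun n => hdens _ _ _) (hdens _ _ _)
      (fun n => (hcoh n).riskEnvelope_nonempty) hcoh'.riskEnvelope_nonempty hs
      (hq.setwise t _ _ _ _ _ _ hs ha hθ) hθ
    exact tendsto_risk_of_tendsto hcoh (tendsto_risk_of_envelope hcoh hcoh' hup hlo)
      (tendsto_toCost hp (fun n => hVm _) (hVm _) (fun n x => hC _)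
        fun x => ((hVc x).tendsto _).comp hθ)

end OneStep

end RiskMDP

namespace RiskMDP

set_option linter.unusedSectionVars false

/-! ### Changing a decision rule at one point -/

section Policies

variable {S A Θ : Type*} [MeasurableSpace S] [MeasurableSpace A] {Γ : S → Θ → Set A}

open Classical in
/-- The decision rule that differs from `g` only in that it takes the action `a` at `(s, θ)`. -/
noncomputable def updateRule (g : S → Θ → A) (s : S) (θ : Θ) (a : A) : S → Θ → A :=
  fun s' θ' => if s' = s ∧ θ' = θ then a else g s' θ'

theorem updateRule_self (g : S → Θ → A) (s : S) (θ : Θ) (a : A) : updateRule g s θ a s θ = a :=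
  if_pos ⟨rfl, rfl⟩

theorem updateRule_mem {g : S → Θ → A} {M : S → Θ → Set A} (hg : ∀ s θ, g s θ ∈ M s θ) {s : S}
    {θ : Θ} {a : A} (ha : a ∈ M s θ) (s' : S) (θ' : Θ) : updateRule g s θ a s' θ' ∈ M s' θ' := by
  unfold updateRule
  split_ifs with h
  · rw [h.1, h.2]; exact ha
  · exact hg s' θ'

theorem measurable_updateRule [MeasurableSingletonClass S] {g : S → Θ → A}
    (hg : ∀ θ, Measurable fun s => g s θ) (s : S) (θ : Θ) (a : A) (θ' : Θ) :
    Measurable fun s' => updateRule g s θ a s' θ' := by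
  classical
  refine Measurable.ite ?_ measurable_const (hg θ')
  -- For fixed `θ'` the rule changes at most at the one state `s`.
  exact Set.Subsingleton.measurableSet fun x hx y hy => hx.1.trans hy.1.symm

end Policies

/-! ### The dynamic programming operator and policy evaluation -/

section DynamicProgramming

variable {S A Θ : Type*} [TopologicalSpace S] [MeasurableSpace S]
  [TopologicalSpace A] [MeasurableSpace A] [TopologicalSpace Θ] [MeasurableSpace Θ]

/-- The one-step risk given by a risk transition mapping and a kernel. -/
noncomputable def stepRisk {p : ℝ≥0∞} {Q : ProbabilityMeasure S}
    (q : S → A → Θ → ProbabilityMeasure S)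
    (σ : CostSpace p Q → S → ProbabilityMeasure S → Θ → ℝ) :
    S → A → Θ → (S → ℝ) → ℝ :=
  fun s a θ f => σ (toCost p Q f) s (q s a θ) θ

/-- The cost of taking the action `a` at `x = (s, θ)`, followed by the discounted risk of the
cost `V` of the next state. -/
def actionCost (R : S → A → Θ → (S → ℝ) → ℝ) (c : S → A → Θ → ℝ) (β : Θ → ℝ) (V : S × Θ → ℝ)
    (x : S × Θ) (a : A) : ℝ :=
  c x.1 a x.2 + β x.2 * R x.1 a x.2 (fun s' => V (s', x.2))

namespace RegularRisk

variable {Γ : S → Θ → Set A} {R : S → A → Θ → (S → ℝ) → ℝ} (hR : RegularRisk Γ R)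
include hR

theorem const {s : S} {a : A} {θ : Θ} (ha : a ∈ Γ s θ) (β : ℝ) : R s a θ (fun _ => β) = β := by
  simpa using hR.affine s a θ ha _ (BddMeas.const 0) 0 β le_rfl

theorem le_affine {s : S} {a : A} {θ : Θ} (ha : a ∈ Γ s θ) {f g : S → ℝ} (hf : BddMeas f)
    (hg : BddMeas g) {α β : ℝ} (hα : 0 ≤ α) (h : ∀ x, f x ≤ α * g x + β) :
    R s a θ f ≤ α * R s a θ g + β := by
  rw [← hR.affine s a θ ha g hg α β hα]
  exact hR.mono s a θ ha _ _ hf (hg.affine α β) h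

theorem affine_le {s : S} {a : A} {θ : Θ} (ha : a ∈ Γ s θ) {f g : S → ℝ} (hf : BddMeas f)
    (hg : BddMeas g) {α β : ℝ} (hα : 0 ≤ α) (h : ∀ x, α * g x + β ≤ f x) :
    α * R s a θ g + β ≤ R s a θ f := by
  rw [← hR.affine s a θ ha g hg α β hα]
  exact hR.mono s a θ ha _ _ (hg.affine α β) hf h

theorem abs_le {s : S} {a : A} {θ : Θ} (ha : a ∈ Γ s θ) {f : S → ℝ} (hf : Measurable f) {C : ℝ}
    (hC : ∀ x, |f x| ≤ C) : |R s a θ f| ≤ C := by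
  have hb : BddMeas f := ⟨hf, C, hC⟩
  refine _root_.abs_le.2 ⟨?_, ?_⟩
  · rw [← hR.const ha (-C)]
    exact hR.mono s a θ ha _ _ (BddMeas.const _) hb fun x => (_root_.abs_le.1 (hC x)).1
  · rw [← hR.const ha C]
    exact hR.mono s a θ ha _ _ hb (BddMeas.const _) fun x => (_root_.abs_le.1 (hC x)).2

/-- With `V` constant in `θ`, the risk of `f` is continuous on the graph of `Γ`; composing with the
measurable map `s ↦ ((s, θ), g s)` into the graph gives measurability. -/
theorem measurable [OpensMeasurableSpace S] [OpensMeasurableSpace A] [OpensMeasurableSpace Θ]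
    [SecondCountableTopology S] [SecondCountableTopology A] [SecondCountableTopology Θ]
    {f : S → ℝ} (hf : BddMeas f) {θ : Θ} {g : S → A} (hg : Measurable g)
    (hgΓ : ∀ s, g s ∈ Γ s θ) : Measurable fun s => R s (g s) θ f := by
  have h1 := continuousOn_iff_continuous_domRestrict.1 (hR.continuousOn (fun x => f x.1)
    (fun _ => hf.1) (fun s => (continuous_const : Continuous fun _ : Θ => f s)) ⟨_, fun x => hf.2.choose_spec x.1⟩)
  have h2 : Measurable fun s => (⟨((s, θ), g s), hgΓ s⟩ : corrGraph fun x : S × Θ => Γ x.1 x.2) :=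
    Measurable.subtype_mk (by fun_prop)
  exact h1.measurable.comp h2

variable [OpensMeasurableSpace S] {c : S → A → Θ → ℝ} {β : Θ → ℝ}

theorem continuousOn_actionCost (hc : Continuous fun x : S × A × Θ => c x.1 x.2.1 x.2.2)
    (hβ : Continuous β) {V : S × Θ → ℝ} (hV : Continuous V) (hVb : ∃ B, ∀ x, |V x| ≤ B) :
    ContinuousOn (fun y : (S × Θ) × A => actionCost R c β V y.1 y.2)
      (corrGraph fun x : S × Θ => Γ x.1 x.2) := by
  have h1 := hR.continuousOn V (fun θ => (hV.comp (by fun_prop : Continuous fun s => (s, θ))).measurable)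
    (fun s => hV.comp (by fun_prop)) hVb
  have h2 : Continuous fun y : (S × Θ) × A => c y.1.1 y.2 y.1.2 :=
    hc.comp (by fun_prop : Continuous fun y : (S × Θ) × A => (y.1.1, y.2, y.1.2))
  have h3 : Continuous fun y : (S × Θ) × A => β y.1.2 := by fun_prop
  exact h2.continuousOn.add (h3.continuousOn.mul h1)

theorem abs_actionCost_le {C : ℝ} (hC : ∀ s a θ, |c s a θ| ≤ C) (hβ : ∀ θ, 0 ≤ β θ ∧ β θ ≤ 1)
    {V : S × Θ → ℝ} (hV : Continuous V) {B : ℝ} (hB : ∀ x, |V x| ≤ B) {x : S × Θ} {a : A}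
    (ha : a ∈ Γ x.1 x.2) : |actionCost R c β V x a| ≤ C + B := by
  have hR1 : |R x.1 a x.2 (fun s' => V (s', x.2))| ≤ B := hR.abs_le ha
    (hV.comp (by fun_prop : Continuous fun s => (s, x.2))).measurable fun s => hB _
  refine (abs_add_le _ _).trans (add_le_add (hC _ _ _) ?_)
  rw [abs_mul, abs_of_nonneg (hβ _).1]
  exact (mul_le_of_le_one_left (abs_nonneg _) (hβ _).2).trans hR1

variable (hΓ : ContinuousActions Γ) (hc : Continuous fun x : S × A × Θ => c x.1 x.2.1 x.2.2)
  (hβc : Continuous β)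
include hΓ hc hβc

theorem argMin_actionCost_nonempty {V : S × Θ → ℝ} (hV : Continuous V)
    (hVb : ∃ B, ∀ x, |V x| ≤ B) (x : S × Θ) :
    (argMin (fun x : S × Θ => Γ x.1 x.2) (actionCost R c β V) x).Nonempty :=
  argMin_nonempty (hΓ.nonempty _ _) (hΓ.compact _ _)
    (continuousOn_section (hR.continuousOn_actionCost hc hβc hV hVb) x)

theorem argMin_actionCost_isCompact {V : S × Θ → ℝ} (hV : Continuous V)
    (hVb : ∃ B, ∀ x, |V x| ≤ B) (x : S × Θ) :
    IsCompact (argMin (fun x : S × Θ => Γ x.1 x.2) (actionCost R c β V) x) :=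
  argMin_isCompact (hΓ.compact _ _)
    (continuousOn_section (hR.continuousOn_actionCost hc hβc hV hVb) x)

theorem upperHemicontinuous_argMin_actionCost {V : S × Θ → ℝ} (hV : Continuous V)
    (hVb : ∃ B, ∀ x, |V x| ≤ B) :
    UpperHemicontinuous (argMin (fun x : S × Θ => Γ x.1 x.2) (actionCost R c β V)) :=
  upperHemicontinuous_argMin (fun _ => hΓ.nonempty _ _) (fun _ => hΓ.compact _ _) hΓ.upper hΓ.lower
    (hR.continuousOn_actionCost hc hβc hV hVb)

theorem continuous_minVal_actionCost {V : S × Θ → ℝ} (hV : Continuous V)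
    (hVb : ∃ B, ∀ x, |V x| ≤ B) :
    Continuous (minVal (fun x : S × Θ => Γ x.1 x.2) (actionCost R c β V)) :=
  continuous_minVal (fun _ => hΓ.nonempty _ _) (fun _ => hΓ.compact _ _) hΓ.upper hΓ.lower
    (hR.continuousOn_actionCost hc hβc hV hVb)

theorem abs_minVal_actionCost_le {C : ℝ} (hC : ∀ s a θ, |c s a θ| ≤ C)
    (hβ : ∀ θ, 0 ≤ β θ ∧ β θ ≤ 1) {V : S × Θ → ℝ} (hV : Continuous V) {B : ℝ}
    (hB : ∀ x, |V x| ≤ B) (x : S × Θ) :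
    |minVal (fun x : S × Θ => Γ x.1 x.2) (actionCost R c β V) x| ≤ C + B := by
  obtain ⟨a, ha⟩ := hR.argMin_actionCost_nonempty hΓ hc hβc hV ⟨B, hB⟩ x
  rw [minVal_eq_of_mem_argMin ha]
  exact hR.abs_actionCost_le hC hβ hV hB ha.1

/-- There are optimal decision rules that are measurable in the state and lower semicontinuous
with respect to a given continuous function of the actions. -/
theorem exists_greedy [BorelSpace A] {l : List (A → ℝ)} (hl : ∀ g ∈ l, Continuous g)
    (hsep : ∀ a b : A, (∀ g ∈ l, g a = g b) → a = b) {V : S × Θ → ℝ} (hV : Continuous V)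
    (hVb : ∃ B, ∀ x, |V x| ≤ B) {f : A → ℝ} (hf : Continuous f) :
    ∃ g : S → Θ → A,
      (∀ s θ, g s θ ∈ argMin (fun x : S × Θ => Γ x.1 x.2) (actionCost R c β V) (s, θ)) ∧
      (∀ θ, Measurable fun s => g s θ) ∧ LowerSemicontinuous fun x : S × Θ => f (g x.1 x.2) := by
  have hne := hR.argMin_actionCost_nonempty hΓ hc hβc hV hVb
  have hcp := hR.argMin_actionCost_isCompact hΓ hc hβc hV hVb
  have hu := hR.upperHemicontinuous_argMin_actionCost hΓ hc hβc hV hVb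
  obtain ⟨g, hg, hgm⟩ := exists_measurable_argMin hl hsep hcp hne hu hf
  refine ⟨g, fun s θ => (hg s θ).1, hgm, ?_⟩
  -- The selector minimizes `f` over the optimal actions, so `f ∘ g` is the minimal value of `f`
  -- over an upper hemicontinuous correspondence.
  have h1 := lowerSemicontinuous_minVal hne hcp hu (F := fun _ => f)
    (hf.comp continuous_snd).continuousOn
  convert h1 using 1
  ext x
  exact (minVal_eq_of_mem_argMin (hg x.1 x.2)).symm

end RegularRisk

/-- The nested risk of a policy under Markov one-step risks. -/
def evalCost (R : ℕ → S → A → Θ → (S → ℝ) → ℝ) (c : ℕ → S → A → Θ → ℝ) (cT : S → Θ → ℝ)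
    (π : ℕ → S → Θ → A) (θ : Θ) : ℕ → ℕ → S → ℝ
  | 0, _, s => cT s θ
  | N + 1, t, s => c t s (π t s θ) θ +
      R t s (π t s θ) θ (fun s' => evalCost R c cT π θ N (t + 1) s')

/-- The value functions of dynamic programming. -/
noncomputable def valueFn (Γ : S → Θ → Set A) (R : ℕ → S → A → Θ → (S → ℝ) → ℝ)
    (c : ℕ → S → A → Θ → ℝ) (cT : S → Θ → ℝ) : ℕ → ℕ → S × Θ → ℝ
  | 0, _ => fun x => cT x.1 x.2
  | N + 1, t => minVal (fun x : S × Θ => Γ x.1 x.2)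
      (actionCost (R t) (c t) (fun _ => 1) (valueFn Γ R c cT N (t + 1)))

variable {Γ : S → Θ → Set A} {R : ℕ → S → A → Θ → (S → ℝ) → ℝ} {c : ℕ → S → A → Θ → ℝ}
  {cT : S → Θ → ℝ}

/-- The Markov property removes the history. It is available only for histories of length `t`, a
condition that the recursion preserves. -/
theorem nestedCost_eq_evalCost {p : ℝ≥0∞} {Q : ℕ → ProbabilityMeasure S}
    {q : ℕ → S → A → Θ → ProbabilityMeasure S}
    {ρ : (t : ℕ) → Θ → List (S × A) → S → A → CostSpace p (Q t) → ℝ}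
    {σ : (t : ℕ) → CostSpace p (Q t) → S → ProbabilityMeasure S → Θ → ℝ}
    (hσ : IsMarkovCoherent Γ Q q ρ σ) {π : ℕ → S → Θ → A} (hπ : π ∈ policies Γ) (θ : Θ) (N : ℕ) :
    ∀ (t : ℕ) (h : List (S × A)), h.length = t → ∀ s, nestedCost ρ c cT π θ N t h s =
      evalCost (fun t => stepRisk (q t) (σ t)) c cT π θ N t s := by
  induction N with
  | zero => intro t h _ s; rfl
  | succ N ih =>
    intro t h ht s
    have h1 : (fun s' => nestedCost ρ c cT π θ N (t + 1) (h ++ [(s, π t s θ)]) s') =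
        fun s' => evalCost (fun t => stepRisk (q t) (σ t)) c cT π θ N (t + 1) s' := by
      funext s'
      exact ih (t + 1) _ (by simp [ht]) s'
    rw [nestedCost, h1, hσ.markov t θ h s _ ht ((hπ t).1 s θ)]
    rfl

section Evaluation

variable [OpensMeasurableSpace S] [OpensMeasurableSpace A] [OpensMeasurableSpace Θ]
    [SecondCountableTopology S] [SecondCountableTopology A] [SecondCountableTopology Θ]

theorem evalCost_bddMeas (hR : ∀ t, RegularRisk Γ (R t)) (hc : ContinuousCost c) {θ : Θ}
    (hcT : BddMeas fun s => cT s θ) {π : ℕ → S → Θ → A} (hπ : π ∈ policies Γ) (N : ℕ) :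
    ∀ t, BddMeas (evalCost R c cT π θ N t) := by
  induction N with
  | zero => intro t; exact hcT
  | succ N ih =>
    intro t
    have h1 := ih (t + 1)
    obtain ⟨C, hC⟩ := hc.bounded t
    have hcm : Measurable fun s => c t s (π t s θ) θ :=
      (hc.continuous t).measurable.comp
        (measurable_id.prodMk (((hπ t).2 θ).prodMk measurable_const))
    refine ⟨hcm.add ((hR t).measurable h1 ((hπ t).2 θ) fun s => (hπ t).1 s θ), ?_⟩
    obtain ⟨hm, B, hB⟩ := h1
    refine ⟨C + B, fun s => (abs_add_le _ _).trans (add_le_add ?_ ?_)⟩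
    · rw [abs_of_nonneg (hc.nonneg _ _ _ _)]
      exact hC _ _ _
    · exact (hR t).abs_le ((hπ t).1 s θ) hm hB

end Evaluation

end DynamicProgramming

end RiskMDP

namespace RiskMDP

variable {S A Θ : Type*} [TopologicalSpace S] [MeasurableSpace S] [OpensMeasurableSpace S]
  [SecondCountableTopology S] [MeasurableSingletonClass S] [TopologicalSpace A] [MeasurableSpace A]
  [BorelSpace A] [SecondCountableTopology A] [TopologicalSpace Θ] [MeasurableSpace Θ]
  [OpensMeasurableSpace Θ] [SecondCountableTopology Θ]
  {Γ : S → Θ → Set A}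

/-! ### Finite horizon: backward induction -/

section FiniteHorizon

variable {R : ℕ → S → A → Θ → (S → ℝ) → ℝ} {c : ℕ → S → A → Θ → ℝ} {cT : S → Θ → ℝ}
  (hΓ : ContinuousActions Γ) (hR : ∀ t, RegularRisk Γ (R t)) (hc : ContinuousCost c)
  (hcT : Continuous fun x : S × Θ => cT x.1 x.2) (hcTb : ∃ C, ∀ s θ, |cT s θ| ≤ C)
include hΓ hR hc hcT hcTb

theorem valueFn_continuous_bounded (N : ℕ) :
    ∀ t, Continuous (valueFn Γ R c cT N t) ∧ ∃ B, ∀ x, |valueFn Γ R c cT N t x| ≤ B := by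
  induction N with
  | zero =>
    intro t
    obtain ⟨C, hC⟩ := hcTb
    exact ⟨hcT, C, fun x => hC _ _⟩
  | succ N ih =>
    intro t
    obtain ⟨hV, B, hB⟩ := ih (t + 1)
    obtain ⟨C, hC⟩ := hc.bounded t
    refine ⟨(hR t).continuous_minVal_actionCost hΓ (hc.continuous t) continuous_const hV ⟨B, hB⟩,
      C + B, fun x => ?_⟩
    refine (hR t).abs_minVal_actionCost_le hΓ (hc.continuous t) continuous_const ?_ (by simp) hV hB x
    intro s a θ
    rw [abs_of_nonneg (hc.nonneg _ _ _ _)]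
    exact hC s a θ

theorem bddMeas_valueFn (N t : ℕ) (θ : Θ) : BddMeas fun s => valueFn Γ R c cT N t (s, θ) := by
  obtain ⟨hV, B, hB⟩ := valueFn_continuous_bounded hΓ hR hc hcT hcTb N t
  exact ⟨(hV.comp (by fun_prop : Continuous fun s => (s, θ))).measurable, B, fun s => hB _⟩

theorem bddMeas_evalCost {π : ℕ → S → Θ → A} (hπ : π ∈ policies Γ) (θ : Θ) (N t : ℕ) :
    BddMeas (evalCost R c cT π θ N t) := by
  obtain ⟨C, hC⟩ := hcTb
  exact evalCost_bddMeas hR hc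
    ⟨(hcT.comp (by fun_prop : Continuous fun s => (s, θ))).measurable, C, fun s => hC s θ⟩ hπ N t

theorem valueFn_succ_le {V : S → ℝ} {N t : ℕ} {s : S} {θ : Θ} {a : A} (ha : a ∈ Γ s θ)
    (hV : BddMeas V) (h : ∀ s', valueFn Γ R c cT N (t + 1) (s', θ) ≤ V s') :
    actionCost (R t) (c t) (fun _ => 1) (valueFn Γ R c cT N (t + 1)) (s, θ) a ≤
      c t s a θ + R t s a θ V := by
  simp only [actionCost, one_mul]
  gcongr
  exact (hR t).mono s a θ ha _ _ (bddMeas_valueFn hΓ hR hc hcT hcTb N (t + 1) θ) hV h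

theorem valueFn_succ_le_actionCost (N t : ℕ) {s : S} {θ : Θ} {a : A} (ha : a ∈ Γ s θ) :
    valueFn Γ R c cT (N + 1) t (s, θ) ≤
      actionCost (R t) (c t) (fun _ => 1) (valueFn Γ R c cT N (t + 1)) (s, θ) a := by
  obtain ⟨hV, hB⟩ := valueFn_continuous_bounded hΓ hR hc hcT hcTb N (t + 1)
  exact minVal_le (Γ := fun x : S × Θ => Γ x.1 x.2)
    ((hR t).argMin_actionCost_nonempty hΓ (hc.continuous t) continuous_const hV hB (s, θ)) ha

/-- Monotonicity of the risk carries the bound on the tail back by one stage. -/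
theorem valueFn_le_evalCost {π : ℕ → S → Θ → A} (hπ : π ∈ policies Γ) (θ : Θ) (N : ℕ) :
    ∀ t s, valueFn Γ R c cT N t (s, θ) ≤ evalCost R c cT π θ N t s := by
  induction N with
  | zero => intro t s; exact le_rfl
  | succ N ih =>
    intro t s
    exact (valueFn_succ_le_actionCost hΓ hR hc hcT hcTb N t ((hπ t).1 s θ)).trans
      (valueFn_succ_le hΓ hR hc hcT hcTb ((hπ t).1 s θ)
        (bddMeas_evalCost hΓ hR hc hcT hcTb hπ θ N (t + 1)) (ih (t + 1)))

omit hΓ hR hc hcT hcTb in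
theorem evalCost_eq_valueFn {π : ℕ → S → Θ → A} {T : ℕ}
    (hπ : ∀ t N, t + (N + 1) = T → ∀ s θ, π t s θ ∈ argMin (fun x : S × Θ => Γ x.1 x.2)
      (actionCost (R t) (c t) (fun _ => 1) (valueFn Γ R c cT N (t + 1))) (s, θ)) (θ : Θ) (N : ℕ) :
    ∀ t, t + N = T → ∀ s, evalCost R c cT π θ N t s = valueFn Γ R c cT N t (s, θ) := by
  induction N with
  | zero => intro t _ s; rfl
  | succ N ih =>
    intro t ht s
    have h1 : (fun s' => evalCost R c cT π θ N (t + 1) s') =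
        fun s' => valueFn Γ R c cT N (t + 1) (s', θ) := funext (ih (t + 1) (by omega))
    rw [valueFn, minVal_eq_of_mem_argMin (hπ t N ht s θ), evalCost, h1]
    simp [actionCost]

/-- Optimal policies for the horizon `T`, lower semicontinuous with respect to a given continuous
function of the actions. -/
theorem exists_optimal_policy {l : List (A → ℝ)} (hl : ∀ g ∈ l, Continuous g)
    (hsep : ∀ a b : A, (∀ g ∈ l, g a = g b) → a = b) {f : A → ℝ} (hf : Continuous f) (T : ℕ) :
    ∃ π ∈ policies Γ,
      (∀ t N, t + (N + 1) = T → ∀ s θ, π t s θ ∈ argMin (fun x : S × Θ => Γ x.1 x.2)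
        (actionCost (R t) (c t) (fun _ => 1) (valueFn Γ R c cT N (t + 1))) (s, θ)) ∧
      ∀ t, LowerSemicontinuous fun x : S × Θ => f (π t x.1 x.2) := by
  -- After the decision at `t < T`, `T - (t + 1)` stages remain. For `t ≥ T` the truncated
  -- subtraction gives `0`; the rule then plays no role for the horizon `T` but is still admissible
  -- and measurable.
  have h : ∀ t, ∃ g : S → Θ → A,
      (∀ s θ, g s θ ∈ argMin (fun x : S × Θ => Γ x.1 x.2)
        (actionCost (R t) (c t) (fun _ => 1) (valueFn Γ R c cT (T - (t + 1)) (t + 1))) (s, θ)) ∧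
      (∀ θ, Measurable fun s => g s θ) ∧ LowerSemicontinuous fun x : S × Θ => f (g x.1 x.2) := by
    intro t
    obtain ⟨hV, hB⟩ := valueFn_continuous_bounded hΓ hR hc hcT hcTb (T - (t + 1)) (t + 1)
    exact (hR t).exists_greedy hΓ (hc.continuous t) continuous_const hl hsep hV hB hf
  choose π hπ hπm hπl using h
  refine ⟨π, fun t => ⟨fun s θ => (hπ t s θ).1, hπm t⟩, fun t N ht s θ => ?_, hπl⟩
  have := hπ t s θ
  rwa [show T - (t + 1) = N by omega] at this

/-- The actions of policies that are optimal at a given state are the minimizers of the dynamic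
programming equation. -/
theorem exists_policy_iff_mem_argMin {l : List (A → ℝ)} (hl : ∀ g ∈ l, Continuous g)
    (hsep : ∀ a b : A, (∀ g ∈ l, g a = g b) → a = b) (N t : ℕ) (s : S) (θ : Θ) (a : A) :
    (∃ π ∈ policies Γ, IsMinOn (fun π' => evalCost R c cT π' θ (N + 1) t s) (policies Γ) π ∧
      π t s θ = a) ↔
    a ∈ argMin (fun x : S × Θ => Γ x.1 x.2)
      (actionCost (R t) (c t) (fun _ => 1) (valueFn Γ R c cT N (t + 1))) (s, θ) := by
  obtain ⟨π, hπ, hπo, -⟩ := exists_optimal_policy hΓ hR hc hcT hcTb hl hsep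
    (f := fun _ => 0) continuous_const (t + (N + 1))
  have hV : argMin (fun x : S × Θ => Γ x.1 x.2)
      (actionCost (R t) (c t) (fun _ => 1) (valueFn Γ R c cT N (t + 1))) (s, θ) |>.Nonempty :=
    ⟨_, hπo t N rfl s θ⟩
  constructor
  · rintro ⟨π', hπ', hmin, rfl⟩
    -- The tail of `π'` costs at least the value function, so its action followed by an optimal tail
    -- costs no more than `π'`, which costs no more than the greedy policy.
    refine mem_argMin_of_le hV ((hπ' t).1 s θ) ?_
    refine (valueFn_succ_le hΓ hR hc hcT hcTb ((hπ' t).1 s θ)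
      (bddMeas_evalCost hΓ hR hc hcT hcTb hπ' θ N (t + 1))
      (valueFn_le_evalCost hΓ hR hc hcT hcTb hπ' θ N (t + 1))).trans ?_
    exact (hmin hπ).trans (evalCost_eq_valueFn hπo θ (N + 1) t rfl s).le
  · intro ha
    classical
    -- The greedy policy is made to take `a` at time `t` in `(s, θ)` only; since `a` is a minimizer
    -- there, it stays greedy everywhere.
    let π' : ℕ → S → Θ → A := Function.update π t (updateRule (π t) s θ a)
    have hπ' : π' ∈ policies Γ := by
      intro r
      by_cases hr : r = t
      · subst hr
        simp only [π', Function.update_self]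
        exact ⟨updateRule_mem (hπ r).1 ha.1, measurable_updateRule (hπ r).2 s θ a⟩
      · simp only [π', Function.update_of_ne hr]
        exact hπ r
    have hπo' : ∀ r N', r + (N' + 1) = t + (N + 1) → ∀ s θ,
        π' r s θ ∈ argMin (fun x : S × Θ => Γ x.1 x.2)
          (actionCost (R r) (c r) (fun _ => 1) (valueFn Γ R c cT N' (r + 1))) (s, θ) := by
      intro r N' hr
      by_cases hrt : r = t
      · subst hrt
        obtain rfl : N' = N := by omega
        simp only [π', Function.update_self]
        exact updateRule_mem (M := fun s θ => argMin (fun x : S × Θ => Γ x.1 x.2)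
          (actionCost (R r) (c r) (fun _ => 1) (valueFn Γ R c cT N' (r + 1))) (s, θ))
          (hπo r N' hr) ha
      · simp only [π', Function.update_of_ne hrt]
        exact hπo r N' hr
    refine ⟨π', hπ', fun π'' hπ'' => ?_, ?_⟩
    · show evalCost R c cT π' θ (N + 1) t s ≤ evalCost R c cT π'' θ (N + 1) t s
      rw [evalCost_eq_valueFn hπo' θ (N + 1) t rfl s]
      exact valueFn_le_evalCost hΓ hR hc hcT hcTb hπ'' θ (N + 1) t s
    · simp only [π', Function.update_self]
      exact updateRule_self _ _ _ _

end FiniteHorizon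

/-! ### Infinite horizon: contraction and convergence of the nested risks -/

section InfiniteHorizon

theorem tendsto_sub_pow_mul {x : ℝ} (h0 : 0 ≤ x) (h1 : x < 1) (r B : ℝ) :
    Tendsto (fun N : ℕ => r - x ^ N * B) atTop (𝓝 r) := by
  simpa using ((tendsto_pow_atTop_nhds_zero_of_lt_one h0 h1).mul_const B).const_sub r

open BoundedContinuousFunction

variable {R : S → A → Θ → (S → ℝ) → ℝ} {c : S → A → Θ → ℝ} {γ : Θ → ℝ} {γbar : ℝ}
  (hΓ : ContinuousActions Γ) (hR : RegularRisk Γ R) (hc : ContinuousCost fun _ : ℕ => c)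
  (hγc : Continuous γ) (hγ : ∀ θ, 0 < γ θ ∧ γ θ ≤ γbar) (hγbar : γbar < 1)

include hc hγc hγ hγbar in
theorem continuousCost_discounted : ContinuousCost (discounted γ c) where
  nonneg t s a θ := mul_nonneg (pow_nonneg (hγ θ).1.le _) (hc.nonneg 0 s a θ)
  bounded t := by
    obtain ⟨C, hC⟩ := hc.bounded 0
    refine ⟨C, fun s a θ => (mul_le_of_le_one_left (hc.nonneg 0 s a θ) ?_).trans (hC s a θ)⟩
    exact pow_le_one₀ (hγ θ).1.le ((hγ θ).2.trans hγbar.le)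
  continuous t := (((hγc.comp (continuous_snd.comp continuous_snd)).pow t)).mul (hc.continuous 0)

include hΓ hR hc hγc hγ hγbar

/-- The stationary dynamic programming equation has a bounded continuous solution. -/
theorem exists_bellman_fixedPoint : ∃ V : S × Θ → ℝ, Continuous V ∧ (∃ B, ∀ x, |V x| ≤ B) ∧
    minVal (fun x : S × Θ => Γ x.1 x.2) (actionCost R c γ V) = V := by
  obtain ⟨C, hC⟩ := hc.bounded 0
  have hC' : ∀ s a θ, |c s a θ| ≤ C := fun s a θ => by
    rw [abs_of_nonneg (hc.nonneg 0 _ _ _)]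
    exact hC s a θ
  have hγ' : ∀ θ, 0 ≤ γ θ ∧ γ θ ≤ 1 := fun θ => ⟨(hγ θ).1.le, (hγ θ).2.trans hγbar.le⟩
  have hcc : Continuous fun x : S × A × Θ => c x.1 x.2.1 x.2.2 := hc.continuous 0
  have hb : ∀ (V : S × Θ →ᵇ ℝ) x, |V x| ≤ ‖V‖ := fun V x => V.norm_coe_le_norm x
  let B : (S × Θ →ᵇ ℝ) → (S × Θ →ᵇ ℝ) := fun V =>
    BoundedContinuousFunction.ofNormedAddCommGroup
      (minVal (fun x : S × Θ => Γ x.1 x.2) (actionCost R c γ V))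
      (hR.continuous_minVal_actionCost hΓ hcc hγc V.continuous ⟨_, hb V⟩) (C + ‖V‖)
      (fun x => hR.abs_minVal_actionCost_le hΓ hcc hγc hC' hγ' V.continuous (hb V) x)
  -- Both action costs are compared at a minimizer for `U`. Since `V ≤ U + dist V U`, monotonicity
  -- and translation equivariance bound the difference of the risks by `dist V U`, and discounting
  -- contracts it.
  have hBle : ∀ (V U : S × Θ →ᵇ ℝ) x, B V x ≤ B U x + γbar.toNNReal * dist V U := by
    intro V U x
    obtain ⟨a, ha⟩ := hR.argMin_actionCost_nonempty hΓ hcc hγc U.continuous ⟨_, hb U⟩ x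
    have h1 : B V x ≤ actionCost R c γ V x a :=
      minVal_le (hR.argMin_actionCost_nonempty hΓ hcc hγc V.continuous ⟨_, hb V⟩ x) ha.1
    have h2 : B U x = actionCost R c γ U x a := minVal_eq_of_mem_argMin ha
    have hm : ∀ W : S × Θ →ᵇ ℝ, BddMeas fun s => W (s, x.2) := fun W =>
      ⟨(W.continuous.comp (by fun_prop : Continuous fun s => (s, x.2))).measurable, ‖W‖,
        fun s => hb W _⟩
    have h3 := hR.le_affine ha.1 (hm V) (hm U) zero_le_one (β := dist V U) fun s => by
      have := (abs_le.1 (Real.dist_eq _ _ ▸ dist_coe_le_dist (f := V) (g := U) (s, x.2))).2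
      linarith
    have h4 : γ x.2 * dist V U ≤ γbar.toNNReal * dist V U :=
      mul_le_mul_of_nonneg_right ((hγ x.2).2.trans (Real.le_coe_toNNReal _)) dist_nonneg
    have h5 := mul_le_mul_of_nonneg_left h3 (hγ x.2).1.le
    rw [h2]
    refine h1.trans ?_
    simp only [actionCost]
    rw [one_mul, mul_add] at h5
    linarith
  have hB : ContractingWith γbar.toNNReal B := by
    refine ⟨by simpa using hγbar, LipschitzWith.of_dist_le_mul fun V U => ?_⟩
    refine (dist_le (by positivity)).2 fun x => ?_
    rw [Real.dist_eq, abs_le]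
    have h1 := hBle V U x
    have h2 := hBle U V x
    rw [dist_comm] at h2
    exact ⟨by linarith, by linarith⟩
  have hfix := hB.fixedPoint_isFixedPt
  refine ⟨hB.fixedPoint, (ContractingWith.fixedPoint B hB).continuous, ⟨_, hb _⟩, ?_⟩
  exact congrArg (fun W : S × Θ →ᵇ ℝ => (W : S × Θ → ℝ)) hfix

omit hΓ in
theorem bddMeas_evalCost_discounted {π : ℕ → S → Θ → A} (hπ : π ∈ policies Γ) (θ : Θ) (N t : ℕ) :
    BddMeas (evalCost (fun _ => R) (discounted γ c) (fun _ _ => 0) π θ N t) :=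
  evalCost_bddMeas (fun _ => hR) (continuousCost_discounted hc hγc hγ hγbar) (BddMeas.const 0) hπ N t

omit hΓ in
-- Costs are nonnegative, so a further stage only increases the nested risk, and the geometric
-- series `γ ^ t * C / (1 - γ)` bounds it.
theorem exists_tendsto_evalCost {π : ℕ → S → Θ → A} (hπ : π ∈ policies Γ) (s : S) (θ : Θ) :
    ∃ J, Tendsto (fun N => evalCost (fun _ => R) (discounted γ c) (fun _ _ => 0) π θ N 0 s) atTop
      (𝓝 J) := by
  obtain ⟨C, hC⟩ := hc.bounded 0
  have hm := bddMeas_evalCost_discounted hR hc hγc hγ hγbar hπ θ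
  have hγ1 : 0 < 1 - γ θ := by linarith [(hγ θ).2]
  have hC0 : 0 ≤ C := (hc.nonneg 0 s (π 0 s θ) θ).trans (hC _ _ _)
  have hmono : ∀ N t s, evalCost (fun _ => R) (discounted γ c) (fun _ _ => 0) π θ N t s ≤
      evalCost (fun _ => R) (discounted γ c) (fun _ _ => 0) π θ (N + 1) t s := by
    intro N
    induction N with
    | zero =>
      intro t s
      simp only [evalCost]
      rw [hR.const ((hπ t).1 s θ), add_zero]
      exact mul_nonneg (pow_nonneg (hγ θ).1.le _) (hc.nonneg 0 _ _ _)
    | succ N ih =>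
      intro t s
      rw [evalCost, evalCost]
      gcongr
      exact hR.mono _ _ _ ((hπ t).1 s θ) _ _ (hm _ _) (hm _ _) (ih (t + 1))
  have hle : ∀ N t s, evalCost (fun _ => R) (discounted γ c) (fun _ _ => 0) π θ N t s ≤
      γ θ ^ t * (C / (1 - γ θ)) := by
    intro N
    induction N with
    | zero =>
      intro t s
      have := (hγ θ).1.le
      simp only [evalCost]
      positivity
    | succ N ih =>
      intro t s
      -- Here `α = 0`: the tail is compared with a constant, whose risk is itself.
      have h1 := hR.le_affine ((hπ t).1 s θ) (hm N (t + 1)) (BddMeas.const 0) le_rfl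
        (β := γ θ ^ (t + 1) * (C / (1 - γ θ))) (fun s' => by simpa using ih (t + 1) s')
      have h2 : discounted γ c t s (π t s θ) θ ≤ γ θ ^ t * C :=
        mul_le_mul_of_nonneg_left (hC _ _ _) (pow_nonneg (hγ θ).1.le _)
      have h3 : γ θ ^ t * (C / (1 - γ θ)) = γ θ ^ t * C + γ θ ^ (t + 1) * (C / (1 - γ θ)) := by
        field_simp
        ring
      rw [evalCost, h3]
      linarith
  exact ⟨_, tendsto_atTop_ciSup (monotone_nat_of_le_succ fun N => hmono N 0 s)
    ⟨_, by rintro _ ⟨N, rfl⟩; exact hle N 0 s⟩⟩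

/-! ### Verification: a fixed point is the optimal value -/

section Verification

variable {V : S × Θ → ℝ} (hV : Continuous V) {B : ℝ} (hB : ∀ x, |V x| ≤ B)
  (hfix : minVal (fun x : S × Θ => Γ x.1 x.2) (actionCost R c γ V) = V)
include hV hB hfix

theorem le_actionCost {s : S} {θ : Θ} {a : A} (ha : a ∈ Γ s θ) :
    V (s, θ) ≤ actionCost R c γ V (s, θ) a := by
  have h := minVal_le (Γ := fun x : S × Θ => Γ x.1 x.2)
    (hR.argMin_actionCost_nonempty hΓ (hc.continuous 0) hγc hV ⟨B, hB⟩ (s, θ)) ha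
  rwa [hfix] at h

/-- The truncation error, at most `B` when `V` is replaced by the zero terminal cost, is discounted
once per stage. The action cost is kept on the left instead of `V`: this finer bound later shows
that optimal first actions are greedy. -/
theorem le_evalCost_succ_of_le {π : ℕ → S → Θ → A} (hπ : π ∈ policies Γ) {θ : Θ} {N t : ℕ}
    (h : ∀ s, γ θ ^ (t + 1) * (V (s, θ) - γ θ ^ N * B) ≤
      evalCost (fun _ => R) (discounted γ c) (fun _ _ => 0) π θ N (t + 1) s) (s : S) :
    γ θ ^ t * (actionCost R c γ V (s, θ) (π t s θ) - γ θ ^ (N + 1) * B) ≤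
      evalCost (fun _ => R) (discounted γ c) (fun _ _ => 0) π θ (N + 1) t s := by
  have hVm : BddMeas fun s => V (s, θ) :=
    ⟨(hV.comp (by fun_prop : Continuous fun s => (s, θ))).measurable, B, fun s => hB _⟩
  have h1 := hR.affine_le ((hπ t).1 s θ)
    (bddMeas_evalCost_discounted hR hc hγc hγ hγbar hπ θ N (t + 1)) hVm
    (pow_nonneg (hγ θ).1.le (t + 1)) (β := -(γ θ ^ (t + 1) * (γ θ ^ N * B)))
    fun s' => by have := h s'; rw [mul_sub] at this; linarith
  rw [evalCost]
  simp only [actionCost, discounted]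
  refine le_trans (le_of_eq ?_) (add_le_add_right h1 _)
  ring

theorem le_evalCost {π : ℕ → S → Θ → A} (hπ : π ∈ policies Γ) (θ : Θ) (N : ℕ) :
    ∀ t s, γ θ ^ t * (V (s, θ) - γ θ ^ N * B) ≤
      evalCost (fun _ => R) (discounted γ c) (fun _ _ => 0) π θ N t s := by
  induction N with
  | zero =>
    intro t s
    have h1 := (abs_le.1 (hB (s, θ))).2
    simp only [evalCost, pow_zero, one_mul]
    exact mul_nonpos_of_nonneg_of_nonpos (pow_nonneg (hγ θ).1.le _) (by linarith)
  | succ N ih =>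
    intro t s
    refine le_trans ?_ (le_evalCost_succ_of_le hΓ hR hc hγc hγ hγbar hV hB hfix hπ (ih (t + 1)) s)
    have h1 := le_actionCost hΓ hR hc hγc hγ hγbar hV hB hfix ((hπ t).1 s θ)
    have h2 := pow_nonneg (hγ θ).1.le t
    gcongr

theorem evalCost_le {π : ℕ → S → Θ → A} (hπ : π ∈ policies Γ)
    (hopt : ∀ t s θ, π t s θ ∈ argMin (fun x : S × Θ => Γ x.1 x.2) (actionCost R c γ V) (s, θ))
    (θ : Θ) (N : ℕ) :
    ∀ t s, evalCost (fun _ => R) (discounted γ c) (fun _ _ => 0) π θ N t s ≤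
      γ θ ^ t * (V (s, θ) + γ θ ^ N * B) := by
  induction N with
  | zero =>
    intro t s
    have h1 := (abs_le.1 (hB (s, θ))).1
    simp only [evalCost, pow_zero, one_mul]
    exact mul_nonneg (pow_nonneg (hγ θ).1.le _) (by linarith)
  | succ N ih =>
    intro t s
    have hVm : BddMeas fun s => V (s, θ) :=
      ⟨(hV.comp (by fun_prop : Continuous fun s => (s, θ))).measurable, B, fun s => hB _⟩
    have h1 := hR.le_affine ((hπ t).1 s θ)
      (bddMeas_evalCost_discounted hR hc hγc hγ hγbar hπ θ N (t + 1)) hVm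
      (pow_nonneg (hγ θ).1.le (t + 1)) (β := γ θ ^ (t + 1) * (γ θ ^ N * B))
      fun s' => by have := ih (t + 1) s'; rw [mul_add] at this; linarith
    have h2 := minVal_eq_of_mem_argMin (hopt t s θ)
    rw [hfix] at h2
    rw [evalCost, h2]
    simp only [actionCost, discounted]
    refine (add_le_add_right h1 _).trans (le_of_eq ?_)
    ring

theorem le_of_tendsto_evalCost {π : ℕ → S → Θ → A} (hπ : π ∈ policies Γ) {s : S} {θ : Θ} {J : ℝ}
    (hJ : Tendsto (fun N => evalCost (fun _ => R) (discounted γ c) (fun _ _ => 0) π θ N 0 s) atTop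
      (𝓝 J)) : V (s, θ) ≤ J :=
  le_of_tendsto_of_tendsto' (tendsto_sub_pow_mul (hγ θ).1.le ((hγ θ).2.trans_lt hγbar) _ B) hJ
    fun N => by simpa using le_evalCost hΓ hR hc hγc hγ hγbar hV hB hfix hπ θ N 0 s

/-- If `π` is optimal at `(s, θ)`, then `J = V (s, θ)`, and this bound makes its first action a
minimizer. -/
theorem actionCost_le_of_tendsto_evalCost {π : ℕ → S → Θ → A} (hπ : π ∈ policies Γ) {s : S} {θ : Θ}
    {J : ℝ}
    (hJ : Tendsto (fun N => evalCost (fun _ => R) (discounted γ c) (fun _ _ => 0) π θ N 0 s) atTop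
      (𝓝 J)) : actionCost R c γ V (s, θ) (π 0 s θ) ≤ J :=
  le_of_tendsto_of_tendsto' ((tendsto_add_atTop_iff_nat 1).2
    (tendsto_sub_pow_mul (hγ θ).1.le ((hγ θ).2.trans_lt hγbar) _ B))
    ((tendsto_add_atTop_iff_nat 1).2 hJ)
    fun N => by
      simpa using le_evalCost_succ_of_le hΓ hR hc hγc hγ hγbar hV hB hfix hπ
        (le_evalCost hΓ hR hc hγc hγ hγbar hV hB hfix hπ θ N (0 + 1)) s

theorem eq_of_tendsto_evalCost {π : ℕ → S → Θ → A} (hπ : π ∈ policies Γ)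
    (hopt : ∀ t s θ, π t s θ ∈ argMin (fun x : S × Θ => Γ x.1 x.2) (actionCost R c γ V) (s, θ))
    {s : S} {θ : Θ} {J : ℝ}
    (hJ : Tendsto (fun N => evalCost (fun _ => R) (discounted γ c) (fun _ _ => 0) π θ N 0 s) atTop
      (𝓝 J)) : J = V (s, θ) := by
  refine le_antisymm ?_ (le_of_tendsto_evalCost hΓ hR hc hγc hγ hγbar hV hB hfix hπ hJ)
  have h := tendsto_sub_pow_mul (hγ θ).1.le ((hγ θ).2.trans_lt hγbar) (V (s, θ)) (-B)
  simp only [mul_neg, sub_neg_eq_add] at h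
  exact le_of_tendsto_of_tendsto' hJ h
    fun N => by simpa using evalCost_le hΓ hR hc hγc hγ hγbar hV hB hfix hπ hopt θ N 0 s

end Verification

end InfiniteHorizon

end RiskMDP

namespace RiskMDP

section Objectives

variable {S A Θ : Type*} [TopologicalSpace S] [MeasurableSpace S] [TopologicalSpace A]
  [MeasurableSpace A] [TopologicalSpace Θ] [MeasurableSpace Θ] {p : ℝ≥0∞}
  {Γ : S → Θ → Set A} {Q : ℕ → ProbabilityMeasure S} {q : ℕ → S → A → Θ → ProbabilityMeasure S}
  {ρ : (t : ℕ) → Θ → List (S × A) → S → A → CostSpace p (Q t) → ℝ}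
  {σ : (t : ℕ) → CostSpace p (Q t) → S → ProbabilityMeasure S → Θ → ℝ}
  {c : ℕ → S → A → Θ → ℝ} {cT : S → Θ → ℝ}

theorem isMinOn_nestedCost_iff (hσ : IsMarkovCoherent Γ Q q ρ σ) {π : ℕ → S → Θ → A}
    (hπ : π ∈ policies Γ) {N t : ℕ} {h : List (S × A)} (ht : h.length = t) {s : S} {θ : Θ} :
    IsMinOn (fun π' => nestedCost ρ c cT π' θ N t h s) (policies Γ) π ↔
      IsMinOn (fun π' => evalCost (fun t => stepRisk (q t) (σ t)) c cT π' θ N t s)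
        (policies Γ) π := by
  simp only [isMinOn_iff]
  refine forall₂_congr fun π' hπ' => ?_
  rw [nestedCost_eq_evalCost hσ hπ θ N t h ht, nestedCost_eq_evalCost hσ hπ' θ N t h ht]

end Objectives

end RiskMDP

/-! ### The theorem for Borel subsets of Euclidean spaces -/

theorem mainTheorem1 {n k : ℕ}
    (S : Set (EuclideanSpace ℝ (Fin n))) (hS : MeasurableSet S)
    (A : Set (EuclideanSpace ℝ (Fin k))) (hA : MeasurableSet A)
    {Θ : Type*} [MetricSpace Θ] [CompactSpace Θ] [MeasurableSpace Θ] [BorelSpace Θ]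
    (p p' : ℝ≥0∞) [Fact (1 ≤ p)] (hp : 1 < p) (hp_top : p < ⊤) (hpp' : p.HolderConjugate p')
    (Γ : S → Θ → Set A) (hΓ : RiskMDP.ContinuousActions Γ) :
    -- finite horizon
    (∀ (Q : ℕ → ProbabilityMeasure S) (q : ℕ → S → A → Θ → ProbabilityMeasure S)
      (c : ℕ → S → A → Θ → ℝ) (cT : S → Θ → ℝ)
      (ρ : (t : ℕ) → Θ → List (S × A) → S → A → RiskMDP.CostSpace p (Q t) → ℝ)
      (σ : (t : ℕ) → RiskMDP.CostSpace p (Q t) → S → ProbabilityMeasure S → Θ → ℝ),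
      RiskMDP.ContinuousKernel p' Q q →
      RiskMDP.ContinuousCost c →
      (∀ s θ, 0 ≤ cT s θ) → (∃ C : ℝ, ∀ s θ, cT s θ ≤ C) →
      Continuous (fun x : S × Θ => cT x.1 x.2) →
      RiskMDP.IsMarkovCoherent Γ Q q ρ σ →
      (∀ t, RiskMDP.EnvelopeContinuous (RiskMDP.DensityMeasures (Q t) p')
        (fun s μ θ => RiskMDP.riskEnvelope (fun v => σ t v s μ θ))) →
      ∀ T : ℕ,
        -- the nested objectives are well defined
        (∀ π ∈ RiskMDP.policies Γ, ∀ t N : ℕ, t + 1 + N = T →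
          ∀ h : List (S × A), h.length = t + 1 → ∀ θ,
            MemLp (RiskMDP.nestedCost ρ c cT π θ N (t + 1) h) p (Q t : Measure S)) ∧
        -- the optimal value is attained and continuous
        (∃ V : S × Θ → ℝ, Continuous V ∧ ∀ s θ,
          IsLeast (RiskMDP.finiteCost ρ c cT T s θ '' RiskMDP.policies Γ) (V (s, θ))) ∧
        -- the same for the problems that start at a later time
        (∀ t N : ℕ, t + N = T → ∃ V : S × Θ → ℝ, Continuous V ∧
          ∀ h : List (S × A), h.length = t → ∀ s θ,
            IsLeast ((fun π => RiskMDP.nestedCost ρ c cT π θ N t h s) '' RiskMDP.policies Γ)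
              (V (s, θ))) ∧
        -- semicontinuity of the optimal policy: the correspondence of optimal actions
        (∀ t N : ℕ, t + (N + 1) = T → ∀ h : List (S × A), h.length = t →
          (∀ s θ, (RiskMDP.optimalActions Γ ρ c cT (N + 1) t h s θ).Nonempty ∧
            IsCompact (RiskMDP.optimalActions Γ ρ c cT (N + 1) t h s θ)) ∧
          UpperHemicontinuous (fun x : S × Θ =>
            RiskMDP.optimalActions Γ ρ c cT (N + 1) t h x.1 x.2)) ∧
        -- semicontinuity of the optimal policy: lower semicontinuous optimal policies
        (∀ f : A → ℝ, Continuous f → ∃ π ∈ RiskMDP.policies Γ,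
          (∀ t N : ℕ, t + N = T → ∀ h : List (S × A), h.length = t → ∀ s θ,
            IsMinOn (fun π' => RiskMDP.nestedCost ρ c cT π' θ N t h s)
              (RiskMDP.policies Γ) π) ∧
          ∀ t < T, LowerSemicontinuous (fun x : S × Θ => f (π t x.1 x.2)))) ∧
    -- stationary infinite horizon
    (∀ (Q : ProbabilityMeasure S) (q : S → A → Θ → ProbabilityMeasure S)
      (c : S → A → Θ → ℝ) (γ : Θ → ℝ) (γbar : ℝ)
      (ρ : ℕ → Θ → List (S × A) → S → A → RiskMDP.CostSpace p Q → ℝ)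
      (σ : RiskMDP.CostSpace p Q → S → ProbabilityMeasure S → Θ → ℝ),
      RiskMDP.ContinuousKernel p' (fun _ => Q) (fun _ => q) →
      RiskMDP.ContinuousCost (fun _ => c) →
      Continuous γ → (∀ θ, 0 < γ θ ∧ γ θ ≤ γbar) → γbar < 1 →
      RiskMDP.IsMarkovCoherent Γ (fun _ => Q) (fun _ => q) ρ (fun _ => σ) →
      RiskMDP.EnvelopeContinuous (RiskMDP.DensityMeasures Q p')
        (fun s μ θ => RiskMDP.riskEnvelope (fun v => σ v s μ θ)) →
        -- the infinite-horizon objective is well defined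
        (∀ π ∈ RiskMDP.policies Γ, ∀ t N : ℕ, ∀ h : List (S × A), h.length = t → ∀ θ,
          MemLp (RiskMDP.nestedCost (Q := fun _ => Q) ρ (RiskMDP.discounted γ c)
            (fun _ _ => 0) π θ N t h) p (Q : Measure S)) ∧
        (∀ π ∈ RiskMDP.policies Γ, ∀ s θ,
          Tendsto (fun N => RiskMDP.finiteCost (Q := fun _ => Q) ρ (RiskMDP.discounted γ c)
            (fun _ _ => 0) N s θ π) atTop
            (𝓝 (RiskMDP.infiniteCost (Q := fun _ => Q) ρ c γ s θ π))) ∧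
        -- the optimal value is attained and continuous
        (∃ V : S × Θ → ℝ, Continuous V ∧ ∀ s θ,
          IsLeast (RiskMDP.infiniteCost (Q := fun _ => Q) ρ c γ s θ '' RiskMDP.policies Γ)
            (V (s, θ))) ∧
        -- semicontinuity of the stationary optimal policy
        (∀ s θ, (RiskMDP.stationaryOptimalActions (Q := fun _ => Q) Γ ρ c γ s θ).Nonempty ∧
          IsCompact (RiskMDP.stationaryOptimalActions (Q := fun _ => Q) Γ ρ c γ s θ)) ∧
        UpperHemicontinuous (fun x : S × Θ =>
          RiskMDP.stationaryOptimalActions (Q := fun _ => Q) Γ ρ c γ x.1 x.2) ∧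
        (∀ f : A → ℝ, Continuous f → ∃ g : S → Θ → A,
          (fun _ : ℕ => g) ∈ RiskMDP.policies Γ ∧
          (∀ s θ, IsMinOn (RiskMDP.infiniteCost (Q := fun _ => Q) ρ c γ s θ)
            (RiskMDP.policies Γ) (fun _ : ℕ => g)) ∧
          LowerSemicontinuous (fun x : S × Θ => f (g x.1 x.2)))) := by
  have hp' : p ≠ ⊤ := hp_top.ne
  -- The coordinates of an action serve as tie-breakers: finitely many continuous functions that
  -- separate points.
  let l : List (A → ℝ) := List.ofFn fun (i : Fin k) (a : A) => (a : EuclideanSpace ℝ (Fin k)) i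
  have hl : ∀ g ∈ l, Continuous g := by
    intro g hg
    obtain ⟨i, rfl⟩ := List.mem_ofFn.1 hg
    fun_prop
  have hsep : ∀ a b : A, (∀ g ∈ l, g a = g b) → a = b := by
    intro a b h
    refine Subtype.ext (PiLp.ext fun i => ?_)
    exact h _ (List.mem_ofFn.2 ⟨i, rfl⟩)
  refine ⟨?_, ?_⟩
  · intro Q q c cT ρ σ hq hc hcT0 hcTb hcT hσ henv T
    have hR : ∀ t, RiskMDP.RegularRisk Γ (RiskMDP.stepRisk (q t) (σ t)) :=
      fun t => hσ.regularRisk hp' hq (henv t)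
    have hcTb' : ∃ C, ∀ s θ, |cT s θ| ≤ C := by
      obtain ⟨C, hC⟩ := hcTb
      exact ⟨C, fun s θ => by rw [abs_of_nonneg (hcT0 s θ)]; exact hC s θ⟩
    have hleast : ∀ t N : ℕ, ∀ h : List (S × A), h.length = t → ∀ s θ,
        IsLeast ((fun π => RiskMDP.nestedCost ρ c cT π θ N t h s) '' RiskMDP.policies Γ)
          (RiskMDP.valueFn Γ (fun t => RiskMDP.stepRisk (q t) (σ t)) c cT N t (s, θ)) := by
      intro t N h ht s θ
      obtain ⟨π, hπ, hπo, -⟩ := RiskMDP.exists_optimal_policy hΓ hR hc hcT hcTb' hl hsep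
        (f := fun _ => 0) continuous_const (t + N)
      refine ⟨⟨π, hπ, ?_⟩, ?_⟩
      · show RiskMDP.nestedCost ρ c cT π θ N t h s = _
        rw [RiskMDP.nestedCost_eq_evalCost hσ hπ θ N t h ht]
        exact RiskMDP.evalCost_eq_valueFn hπo θ N t rfl s
      · rintro _ ⟨π', hπ', rfl⟩
        show _ ≤ RiskMDP.nestedCost ρ c cT π' θ N t h s
        rw [RiskMDP.nestedCost_eq_evalCost hσ hπ' θ N t h ht]
        exact RiskMDP.valueFn_le_evalCost hΓ hR hc hcT hcTb' hπ' θ N t s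
    have hopt : ∀ t N : ℕ, ∀ h : List (S × A), h.length = t → ∀ s θ,
        RiskMDP.optimalActions Γ ρ c cT (N + 1) t h s θ =
          RiskMDP.argMin (fun x : S × Θ => Γ x.1 x.2)
            (RiskMDP.actionCost (RiskMDP.stepRisk (q t) (σ t)) (c t) (fun _ => 1)
              (RiskMDP.valueFn Γ (fun t => RiskMDP.stepRisk (q t) (σ t)) c cT N (t + 1)))
            (s, θ) := by
      intro t N h ht s θ
      ext a
      rw [← RiskMDP.exists_policy_iff_mem_argMin hΓ hR hc hcT hcTb' hl hsep N t s θ a]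
      refine exists_congr fun π => and_congr_right fun hπ => ?_
      rw [RiskMDP.isMinOn_nestedCost_iff hσ hπ ht]
    refine ⟨?_, ?_, ?_, ?_, ?_⟩
    · intro π hπ t N _ h ht θ
      have := (RiskMDP.bddMeas_evalCost hΓ hR hc hcT hcTb' hπ θ N (t + 1)).memLp
        (p := p) (Q := Q t)
      rwa [← funext (RiskMDP.nestedCost_eq_evalCost hσ hπ θ N (t + 1) h ht)] at this
    · exact ⟨_, (RiskMDP.valueFn_continuous_bounded hΓ hR hc hcT hcTb' T 0).1,
        fun s θ => hleast 0 T [] rfl s θ⟩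
    · intro t N _
      exact ⟨_, (RiskMDP.valueFn_continuous_bounded hΓ hR hc hcT hcTb' N t).1, hleast t N⟩
    · intro t N _ h ht
      obtain ⟨hV, hB⟩ := RiskMDP.valueFn_continuous_bounded hΓ hR hc hcT hcTb' N (t + 1)
      simp only [hopt t N h ht]
      exact ⟨fun s θ =>
        ⟨(hR t).argMin_actionCost_nonempty hΓ (hc.continuous t) continuous_const hV hB _,
          (hR t).argMin_actionCost_isCompact hΓ (hc.continuous t) continuous_const hV hB _⟩,
        (hR t).upperHemicontinuous_argMin_actionCost hΓ (hc.continuous t) continuous_const hV hB⟩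
    · intro f hf
      obtain ⟨π, hπ, hπo, hπl⟩ :=
        RiskMDP.exists_optimal_policy hΓ hR hc hcT hcTb' hl hsep hf T
      refine ⟨π, hπ, fun t N ht h hh s θ => ?_, fun t _ => hπl t⟩
      rw [RiskMDP.isMinOn_nestedCost_iff hσ hπ hh]
      intro π' hπ'
      show RiskMDP.evalCost _ c cT π θ N t s ≤ RiskMDP.evalCost _ c cT π' θ N t s
      rw [RiskMDP.evalCost_eq_valueFn hπo θ N t ht s]
      exact RiskMDP.valueFn_le_evalCost hΓ hR hc hcT hcTb' hπ' θ N t s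
  · intro Q q c γ γbar ρ σ hq hc hγc hγ hγbar hσ henv
    have hR : RiskMDP.RegularRisk Γ (RiskMDP.stepRisk q σ) :=
      hσ.regularRisk (t := 0) hp' hq henv
    have hnest := fun {π : ℕ → S → Θ → A} (hπ : π ∈ RiskMDP.policies Γ) (θ : Θ) (N : ℕ) =>
      RiskMDP.nestedCost_eq_evalCost (c := RiskMDP.discounted γ c) (cT := fun _ _ => 0) hσ hπ θ N
    have hlim : ∀ π ∈ RiskMDP.policies Γ, ∀ s θ,
        Tendsto (fun N => RiskMDP.finiteCost (Q := fun _ => Q) ρ (RiskMDP.discounted γ c)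
          (fun _ _ => 0) N s θ π) atTop
          (𝓝 (RiskMDP.infiniteCost (Q := fun _ => Q) ρ c γ s θ π)) := by
      intro π hπ s θ
      obtain ⟨J, hJ⟩ := RiskMDP.exists_tendsto_evalCost hR hc hγc hγ hγbar hπ s θ
      have hJ' : Tendsto (fun N => RiskMDP.finiteCost (Q := fun _ => Q) ρ
          (RiskMDP.discounted γ c) (fun _ _ => 0) N s θ π) atTop (𝓝 J) :=
        hJ.congr fun N => (hnest hπ θ N 0 [] rfl s).symm
      rw [RiskMDP.infiniteCost, hJ'.limUnder_eq]
      exact hJ'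
    have hlim' : ∀ π ∈ RiskMDP.policies Γ, ∀ s θ,
        Tendsto (fun N => RiskMDP.evalCost (fun _ => RiskMDP.stepRisk q σ)
          (RiskMDP.discounted γ c) (fun _ _ => 0) π θ N 0 s) atTop
          (𝓝 (RiskMDP.infiniteCost (Q := fun _ => Q) ρ c γ s θ π)) :=
      fun π hπ s θ => (hlim π hπ s θ).congr fun N => hnest hπ θ N 0 [] rfl s
    obtain ⟨V, hV, ⟨B, hB⟩, hfix⟩ :=
      RiskMDP.exists_bellman_fixedPoint hΓ hR hc hγc hγ hγbar
    have hge : ∀ π ∈ RiskMDP.policies Γ, ∀ s θ,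
        V (s, θ) ≤ RiskMDP.infiniteCost (Q := fun _ => Q) ρ c γ s θ π := fun π hπ s θ =>
      RiskMDP.le_of_tendsto_evalCost hΓ hR hc hγc hγ hγbar hV hB hfix hπ (hlim' π hπ s θ)
    have heq : ∀ g : S → Θ → A, (fun _ : ℕ => g) ∈ RiskMDP.policies Γ →
        (∀ s θ, g s θ ∈ RiskMDP.argMin (fun x : S × Θ => Γ x.1 x.2)
          (RiskMDP.actionCost (RiskMDP.stepRisk q σ) c γ V) (s, θ)) → ∀ s θ,
        RiskMDP.infiniteCost (Q := fun _ => Q) ρ c γ s θ (fun _ => g) = V (s, θ) :=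
      fun g hg ho s θ => RiskMDP.eq_of_tendsto_evalCost hΓ hR hc hγc hγ hγbar hV hB hfix hg
        (fun _ => ho) (hlim' _ hg s θ)
    have hmin : ∀ g : S → Θ → A, (fun _ : ℕ => g) ∈ RiskMDP.policies Γ →
        (∀ s θ, g s θ ∈ RiskMDP.argMin (fun x : S × Θ => Γ x.1 x.2)
          (RiskMDP.actionCost (RiskMDP.stepRisk q σ) c γ V) (s, θ)) → ∀ s θ,
        IsMinOn (RiskMDP.infiniteCost (Q := fun _ => Q) ρ c γ s θ) (RiskMDP.policies Γ)
          (fun _ : ℕ => g) := by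
      intro g hg ho s θ π hπ
      show RiskMDP.infiniteCost (Q := fun _ => Q) ρ c γ s θ (fun _ => g) ≤ _
      rw [heq g hg ho]
      exact hge π hπ s θ
    have hgreedy := fun {f : A → ℝ} (hf : Continuous f) =>
      hR.exists_greedy hΓ (hc.continuous 0) hγc hl hsep hV ⟨B, hB⟩ hf
    obtain ⟨g₀, hg₀, hg₀m, -⟩ := hgreedy (continuous_const (y := 0))
    have hg₀p : (fun _ : ℕ => g₀) ∈ RiskMDP.policies Γ :=
      fun _ => ⟨fun s θ => (hg₀ s θ).1, hg₀m⟩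
    have hopt : ∀ s θ, RiskMDP.stationaryOptimalActions (Q := fun _ => Q) Γ ρ c γ s θ =
        RiskMDP.argMin (fun x : S × Θ => Γ x.1 x.2)
          (RiskMDP.actionCost (RiskMDP.stepRisk q σ) c γ V) (s, θ) := by
      intro s θ
      ext a
      constructor
      · rintro ⟨g, hg, hgm, rfl⟩
        refine RiskMDP.mem_argMin_of_le ⟨_, hg₀ s θ⟩ ((hg 0).1 s θ) ?_
        have h1 : RiskMDP.infiniteCost (Q := fun _ => Q) ρ c γ s θ (fun _ => g) ≤
            RiskMDP.infiniteCost (Q := fun _ => Q) ρ c γ s θ (fun _ => g₀) := hgm hg₀p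
        rw [heq g₀ hg₀p hg₀] at h1
        rw [hfix]
        exact (RiskMDP.actionCost_le_of_tendsto_evalCost hΓ hR hc hγc hγ hγbar hV hB hfix hg
          (hlim' _ hg s θ)).trans h1
      · intro ha
        -- The stationary rule is altered at `(s, θ)` for all times at once; it remains greedy
        -- everywhere and is therefore optimal.
        have hg := RiskMDP.updateRule_mem (M := fun s θ => RiskMDP.argMin
          (fun x : S × Θ => Γ x.1 x.2)
          (RiskMDP.actionCost (RiskMDP.stepRisk q σ) c γ V) (s, θ)) hg₀ ha
        have hgp : (fun _ : ℕ => RiskMDP.updateRule g₀ s θ a) ∈ RiskMDP.policies Γ :=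
          fun _ => ⟨fun s' θ' => (hg s' θ').1, RiskMDP.measurable_updateRule hg₀m s θ a⟩
        exact ⟨_, hgp, hmin _ hgp hg s θ, RiskMDP.updateRule_self g₀ s θ a⟩
    refine ⟨?_, hlim, ?_, ?_, ?_, ?_⟩
    · intro π hπ t N h ht θ
      have := (RiskMDP.bddMeas_evalCost_discounted hR hc hγc hγ hγbar hπ θ N t).memLp
        (p := p) (Q := Q)
      rwa [← funext (hnest hπ θ N t h ht)] at this
    · refine ⟨V, hV, fun s θ => ⟨⟨_, hg₀p, heq g₀ hg₀p hg₀ s θ⟩, ?_⟩⟩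
      rintro _ ⟨π, hπ, rfl⟩
      exact hge π hπ s θ
    · intro s θ
      rw [hopt]
      exact ⟨hR.argMin_actionCost_nonempty hΓ (hc.continuous 0) hγc hV ⟨B, hB⟩ _,
        hR.argMin_actionCost_isCompact hΓ (hc.continuous 0) hγc hV ⟨B, hB⟩ _⟩
    · simp only [hopt]
      exact hR.upperHemicontinuous_argMin_actionCost hΓ (hc.continuous 0) hγc hV ⟨B, hB⟩
    · intro f hf
      obtain ⟨g, hg, hgm, hgl⟩ := hgreedy hf
      have hgp : (fun _ : ℕ => g) ∈ RiskMDP.policies Γ := fun _ => ⟨fun s θ => (hg s θ).1, hgm⟩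
      exact ⟨g, hgp, hmin g hgp hg, hgl⟩
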